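/- **Setting.** $G$ single-antenna transmitters serve $G$ groups of single-antenna users through an amplify-and-forward relay with $L$ antennas; group $k$ has $m_k$ users and $M=\sum_k m_k$. Given are transmit powers $P_j\ge0$, channels $f_j\in\mathbb C^L$ (transmitter $j$ to relay) and $g_{k,i}\in\mathbb C^L$ (relay to user $i$ of group $k$), noise variances $\sigma_\ell^2>0$ at the relay antennas and $\sigma_{k,i}^2>0$ at the users, a total power threshold $\bar P_0>0$ and per-antenna thresholds $\bar P_1,\dots,\bar P_L>0$. Put $\Sigma_L=\mathrm{Diag}(\sigma_1^2,\dots,\sigma_L^2)$ and, with $f^*$ the entrywise conjugate, $K=\sum_{j}P_jf_j^*(f_j^*)^H+\Sigma_L$, $$A_{k,i}=\frac{P_k}{\sigma_{k,i}^2}(f_k^*\otimes g_{k,i})(f_k^*\otimes g_{k,i})^H,\qquad C_{k,i}=\sum_{j\ne k}\frac{P_j}{\sigma_{k,i}^2}(f_j^*\otimes g_{k,i})(f_j^*\otimes g_{k,i})^H+\frac{1}{\sigma_{k,i}^2}\Sigma_L\otimes g_{k,i}g_{k,i}^H,$$ $$D_0=K\otimes I_L,\qquad D_\ell=K\otimes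 e_\ell e_\ell^H\ (1\le\ell\le L).$$ With $A\bullet B=\mathrm{Tr}(A^HB)$ let $\gamma(W)=\min_{k,i}\frac{A_{k,i}\bullet W}{C_{k,i}\bullet W+1}$. Problem (SDR) is to maximize $\gamma(W)$ over the Hermitian positive semidefinite matrices $W$ of order $L^2$ with $D_\ell\bullet W\le\bar P_\ell$ for $\ell=0,1,\dots,L$. **Randomization procedure.** Input: an optimal solution $W^\star$ of (SDR) and $N\ge1$. If $\mathrm{rank}(W^\star)\le1$, output some $\hat w$ with $W^\star=\hat w\hat w^H$. Otherwise draw independent $\xi^1,\dots,\xi^N\sim\mathcal{CN}(0,W^\star)$ (circularly symmetric complex Gaussian), put $\hat w^n=\xi^n\min_{0\le\ell\le L}\sqrt{\bar P_\ell/(D_\ell\bullet\xi^n(\xi^n)^H)}$ (a quotient with denominator $0$ counts as $+\infty$; $\hat w^n=0$ if $\xi^n=0$), and output $\hat w=\hat w^{n}$ for some $n$ that maximizes $\gamma(\hat w^n(\hat w^n)^H)$. Let $r_{\sf SDR}=\log(1+\gamma(W^\star))$ and $r_{\sf BF}=\log(1+\gamma(\hat w\hat w^H))$, with natural logarithms (nats/s/Hz).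 **Theorem.** Let $M\ge1$ and $L\ge2$. (a) If $M+L\le3$, an optimal solution $W^\star$ of (SDR) with $\mathrm{rank}(W^\star)\le1$ exists and can be found efficiently: it can be computed from the real and imaginary parts of the data, exactly, by a program over the reals (rational constants, $+,-,\times,/$, square roots, sign tests) with a number of instructions that is polynomial in $G+M+L$. For every such $W^\star$, and every $N\ge1$, the procedure has an output on input $W^\star$, and every output $\hat w$ satisfies $r_{\sf BF}=r_{\sf SDR}$. (b) If $M+L>3$, then for every optimal solution $W^\star$ of (SDR) and every $N\ge1$, the output $\hat w$ of the procedure satisfies $$r_{\sf SDR}-r_{\sf BF}\le\log M+\log\bigl(\log(3(L+1))+\tfrac16\bigr)+\log48$$ with probability at least $1-(5/6)^N$. -/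

import Mathlib

open MeasureTheory ProbabilityTheory
open scoped Kronecker ComplexConjugate ComplexOrder

noncomputable section

/-- Data of a one-way multigroup multicast MIMO relay network: `G` transmitters (one per group),
`m k` users in group `k`, and a relay with `L` antennas. -/
structure RelayNetwork (G : ℕ) (m : Fin G → ℕ) (L : ℕ) where
  /-- transmit powers -/
  P : Fin G → ℝ
  /-- channels from the transmitters to the relay antennas -/
  f : Fin G → Fin L → ℂ
  /-- channels from the relay antennas to the users -/
  g : (Σ k, Fin (m k)) → Fin L → ℂ
  /-- standard deviations of the noise at the relay antennas -/
  σR : Fin L → ℝ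
  /-- standard deviations of the noise at the users -/
  σU : (Σ k, Fin (m k)) → ℝ
  /-- power thresholds: `none` is the total power, `some ℓ` the power of antenna `ℓ` -/
  Pbar : Option (Fin L) → ℝ
  P_nonneg : ∀ j, 0 ≤ P j
  σR_pos : ∀ l, 0 < σR l
  σU_pos : ∀ u, 0 < σU u
  Pbar_pos : ∀ l, 0 < Pbar l

/-- Index set of `vec V` for an `L × L` matrix `V`: the pair `(c, r)` is column `c`, row `r`. -/
abbrev VecIdx (L : ℕ) : Type := Fin L × Fin L

/-- The inner product `A • B = Tr (Aᴴ B)`; it is real for Hermitian matrices. -/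
def matInner {n : Type*} [Fintype n] (A B : Matrix n n ℂ) : ℝ :=
  (Matrix.trace (A.conjTranspose * B)).re

/-- The rank-one matrix `w wᴴ`. -/
def outer {n : Type*} (w : n → ℂ) : Matrix n n ℂ :=
  Matrix.vecMulVec w (star w)

namespace RelayNetwork

variable {G : ℕ} {m : Fin G → ℕ} {L : ℕ}

/-- The noise covariance `Σ_L = Diag (σ₁², …, σ_L²)` at the relay. -/
def noiseCov (S : RelayNetwork G m L) : Matrix (Fin L) (Fin L) ℂ :=
  Matrix.diagonal fun l => ((S.σR l ^ 2 : ℝ) : ℂ)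

/-- The vector `f_j^* ⊗ g_u`. -/
def chan (S : RelayNetwork G m L) (j : Fin G) (u : Σ k, Fin (m k)) : VecIdx L → ℂ :=
  fun p => conj (S.f j p.1) * S.g u p.2

/-- The matrix `A_{k,i}` of user `u = (k, i)`. -/
def A (S : RelayNetwork G m L) (u : Σ k, Fin (m k)) : Matrix (VecIdx L) (VecIdx L) ℂ :=
  ((S.P u.1 / S.σU u ^ 2 : ℝ) : ℂ) • outer (S.chan u.1 u)

/-- The matrix `C_{k,i}` of user `u = (k, i)`. -/
def C (S : RelayNetwork G m L) (u : Σ k, Fin (m k)) : Matrix (VecIdx L) (VecIdx L) ℂ :=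
  (∑ j ∈ Finset.univ.filter (fun j => j ≠ u.1),
      ((S.P j / S.σU u ^ 2 : ℝ) : ℂ) • outer (S.chan j u))
    + ((1 / S.σU u ^ 2 : ℝ) : ℂ) • (S.noiseCov ⊗ₖ outer (S.g u))

/-- The matrix `∑ⱼ Pⱼ fⱼ^* (fⱼ^*)ᴴ + Σ_L`. -/
def rxCov (S : RelayNetwork G m L) : Matrix (Fin L) (Fin L) ℂ :=
  (∑ j, ((S.P j : ℝ) : ℂ) • outer (star (S.f j))) + S.noiseCov

/-- The power-constraint matrices: `D none` is `D₀` (total power), `D (some ℓ)` is `D_ℓ`. -/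
def D (S : RelayNetwork G m L) : Option (Fin L) → Matrix (VecIdx L) (VecIdx L) ℂ
  | none => S.rxCov ⊗ₖ (1 : Matrix (Fin L) (Fin L) ℂ)
  | some l => S.rxCov ⊗ₖ Matrix.single l l (1 : ℂ)

/-- The worst-user SINR `γ(W)`, a minimum over all users. -/
def gam (S : RelayNetwork G m L) (W : Matrix (VecIdx L) (VecIdx L) ℂ) : ℝ :=
  ⨅ u : Σ k, Fin (m k), matInner (S.A u) W / (matInner (S.C u) W + 1)

/-- The feasible set of (SDR). -/
def sdrFeasible (S : RelayNetwork G m L) : Set (Matrix (VecIdx L) (VecIdx L) ℂ) :=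
  {W | W.PosSemidef ∧ ∀ l, matInner (S.D l) W ≤ S.Pbar l}

/-- `W` is an optimal solution of (SDR). -/
def IsSDROptimal (S : RelayNetwork G m L) (W : Matrix (VecIdx L) (VecIdx L) ℂ) : Prop :=
  W ∈ S.sdrFeasible ∧ ∀ W' ∈ S.sdrFeasible, S.gam W' ≤ S.gam W

/-- The rate `log (1 + γ(W))` in nats/s/Hz. -/
def rate (S : RelayNetwork G m L) (W : Matrix (VecIdx L) (VecIdx L) ℂ) : ℝ :=
  Real.log (1 + S.gam W)

/-- The vector `ξ · min_ℓ √(P̄_ℓ / (D_ℓ • ξξᴴ))`. The minimum is taken in `[0, ∞]`, so that a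
constraint with `D_ℓ • ξξᴴ = 0` imposes no restriction. (All of these numbers vanish only
for `ξ = 0`, as `D₀` is positive definite, and then the result is `0`.) -/
def rescale (S : RelayNetwork G m L) (ξ : VecIdx L → ℂ) : VecIdx L → ℂ :=
  ((⨅ l : Option (Fin L),
      (ENNReal.ofReal (S.Pbar l) / ENNReal.ofReal (matInner (S.D l) (outer ξ))) ^ (1 / 2 : ℝ)).toReal
    : ℂ) • ξ

/-- `w` is an output of the rank-one Gaussian randomization procedure with input `W` and draws
`ξ 0, …, ξ (N-1)`. It is a relation as the factorization `W = w wᴴ` and the maximizing index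
need not be unique. -/
def IsOutput (S : RelayNetwork G m L) (W : Matrix (VecIdx L) (VecIdx L) ℂ) {N : ℕ}
    (ξ : Fin N → VecIdx L → ℂ) (w : VecIdx L → ℂ) : Prop :=
  if W.rank ≤ 1 then W = outer w
  else ∃ n : Fin N,
    (∀ n', S.gam (outer (S.rescale (ξ n'))) ≤ S.gam (outer (S.rescale (ξ n)))) ∧
      w = S.rescale (ξ n)

end RelayNetwork

/-- `ξ ∼ CN(0, W)` under `μ`: `ξ` is a complex random vector with (real) jointly Gaussian
components, mean zero, covariance `E[ξ ξᴴ] = W` and, by circular symmetry, `E[ξ ξᵀ] = 0`. -/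
structure IsCircularGaussian {Ω : Type*} [MeasurableSpace Ω] {n : Type*} [Fintype n]
    (ξ : Ω → n → ℂ) (W : Matrix n n ℂ) (μ : Measure Ω) : Prop where
  gaussian : HasGaussianLaw ξ μ
  mean : ∀ i, ∫ ω, ξ ω i ∂μ = 0
  cov : ∀ i j, ∫ ω, ξ ω i * conj (ξ ω j) ∂μ = W i j
  pseudoCov : ∀ i j, ∫ ω, ξ ω i * ξ ω j ∂μ = 0

/-- Programs over the reals with inputs indexed by `ι`: rational constants, the four arithmetic
operations, square roots, and branching on the sign of a computed number. -/
inductive RealProgram (ι : Type) : Type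
  | input : ι → RealProgram ι
  | const : ℚ → RealProgram ι
  | add : RealProgram ι → RealProgram ι → RealProgram ι
  | sub : RealProgram ι → RealProgram ι → RealProgram ι
  | mul : RealProgram ι → RealProgram ι → RealProgram ι
  | div : RealProgram ι → RealProgram ι → RealProgram ι
  | sqrt : RealProgram ι → RealProgram ι
  | ifNonneg : RealProgram ι → RealProgram ι → RealProgram ι → RealProgram ι

namespace RealProgram

variable {ι : Type}

/-- The value computed by a program. -/
def eval (x : ι → ℝ) : RealProgram ι → ℝ
  | input i => x i
  | const q => (q : ℝ)
  | add a b => a.eval x + b.eval x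
  | sub a b => a.eval x - b.eval x
  | mul a b => a.eval x * b.eval x
  | div a b => a.eval x / b.eval x
  | sqrt a => Real.sqrt (a.eval x)
  | ifNonneg c a b => if 0 ≤ c.eval x then a.eval x else b.eval x

/-- Number of instructions, with unit cost for each; both branches of a test are counted, so this
bounds the number of executed steps. -/
def cost : RealProgram ι → ℕ
  | input _ => 1
  | const _ => 1
  | add a b => a.cost + b.cost + 1
  | sub a b => a.cost + b.cost + 1
  | mul a b => a.cost + b.cost + 1
  | div a b => a.cost + b.cost + 1
  | sqrt a => a.cost + 1
  | ifNonneg c a b => c.cost + a.cost + b.cost + 1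

end RealProgram

/-- The real numbers that describe a relay network. -/
inductive NetworkInput (G : ℕ) (m : Fin G → ℕ) (L : ℕ) : Type
  | power : Fin G → NetworkInput G m L
  | fRe : Fin G → Fin L → NetworkInput G m L
  | fIm : Fin G → Fin L → NetworkInput G m L
  | gRe : (Σ k, Fin (m k)) → Fin L → NetworkInput G m L
  | gIm : (Σ k, Fin (m k)) → Fin L → NetworkInput G m L
  | sigmaR : Fin L → NetworkInput G m L
  | sigmaU : (Σ k, Fin (m k)) → NetworkInput G m L
  | bound : Option (Fin L) → NetworkInput G m L

namespace RelayNetwork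

variable {G : ℕ} {m : Fin G → ℕ} {L : ℕ}

/-- The description of a relay network by real numbers. -/
def encode (S : RelayNetwork G m L) : NetworkInput G m L → ℝ
  | .power j => S.P j
  | .fRe j l => (S.f j l).re
  | .fIm j l => (S.f j l).im
  | .gRe u l => (S.g u l).re
  | .gIm u l => (S.g u l).im
  | .sigmaR l => S.σR l
  | .sigmaU u => S.σU u
  | .bound l => S.Pbar l

end RelayNetwork

/-- An algorithm whose input is a relay network of given dimensions and whose output is a complex
matrix of order `L²`: one real program for the real part and one for the imaginary part of every
entry. -/
structure MatrixSolver (G : ℕ) (m : Fin G → ℕ) (L : ℕ) where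
  re : VecIdx L → VecIdx L → RealProgram (NetworkInput G m L)
  im : VecIdx L → VecIdx L → RealProgram (NetworkInput G m L)

namespace MatrixSolver

variable {G : ℕ} {m : Fin G → ℕ} {L : ℕ}

/-- The matrix computed by the algorithm. -/
def run (A : MatrixSolver G m L) (S : RelayNetwork G m L) : Matrix (VecIdx L) (VecIdx L) ℂ :=
  Matrix.of fun p q => ⟨(A.re p q).eval S.encode, (A.im p q).eval S.encode⟩

/-- The total number of instructions. -/
def cost (A : MatrixSolver G m L) : ℕ :=
  ∑ p, ∑ q, ((A.re p q).cost + (A.im p q).cost)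

end MatrixSolver

end

/-! ### The real inner product `A • B`, rank-one matrices and positive semidefinite matrices. -/

section MatInner

variable {n : Type*} [Fintype n]

/-! Gap for randomization. Let ξ ∼ CN(0, W). A draw is good (`goodDraws`) if every power form is at
most β times its threshold and, for every user, the signal form relative to its mean, times κ, is at
least (interference + β) / (mean interference + 1). Rescaling a good draw multiplies squared norms
by some t² ≥ 1/β. Hence the unit noise of a user is at most t²β, and γ(W) ≤ κ γ of the rescaled draw
(`gam_le_of_mem_goodDraws`). A union bound controls the bad draws. A power form Q of mean τ
satisfies E exp(Q/(2τ)) ≤ 2, so Markov's inequality bounds its failure by 2 exp(-β/2)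
(`measure_matInner_gt_le`). For a user with channel vector a, write ξ = s b + residual, where s =
aᴴξ is independent of the residual. Since P(|s|² ≤ y) ≤ y / E|s|², conditioning on the residual
leaves only its mean interference to be estimated, and the failure probability is at most β/(κ - 2)
(`measure_rankOne_lt_le`). With β = 2 log(3(L+1)) the L + 1 power constraints cost 2/3 in total, and
κ = 48M(β/2 + 1/6) keeps the M users below 1/6. So a draw is bad with probability at most 5/6, and N
independent draws are all bad with probability at most (5/6)^N.

Exact case. The dimension bounds force two relay antennas and one user. Signal plus interference
plus relay noise is then a multiple of the received power Q = (K ⊗ g gᴴ) • W, so the SINR grows with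
the signal and, for a fixed signal fraction of Q, with Q. Cauchy–Schwarz in the norm of K bounds the
signal fraction, and a weighted Cauchy–Schwarz inequality with Lagrange multipliers bounds Q. One
product vector attains both bounds: a multiple of K⁻¹f* on the receiving side and phase-aligned
water-filling amplitudes on the transmitting side (`isSDROptimal_matched`). For two antennas all of
this is in closed form with arithmetic, square roots and sign tests. The only part that grows with
the dimensions is the sum over transmitters in K, so the program has size linear in G. -/

lemma matInner_add_left (A B W : Matrix n n ℂ) :
    matInner (A + B) W = matInner A W + matInner B W := by
  simp [matInner, Matrix.conjTranspose_add, add_mul]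

lemma matInner_sub_left (A B W : Matrix n n ℂ) :
    matInner (A - B) W = matInner A W - matInner B W := by
  simp [matInner, Matrix.conjTranspose_sub, sub_mul]

lemma matInner_smul_left (c : ℝ) (A W : Matrix n n ℂ) :
    matInner ((c : ℂ) • A) W = c * matInner A W := by
  simp [matInner, Matrix.conjTranspose_smul]

lemma matInner_sum_left {ι : Type*} (s : Finset ι) (A : ι → Matrix n n ℂ) (W : Matrix n n ℂ) :
    matInner (∑ i ∈ s, A i) W = ∑ i ∈ s, matInner (A i) W := by
  simp [matInner, Matrix.conjTranspose_sum, Finset.sum_mul, Matrix.trace_sum]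

lemma matInner_outer_left (a : n → ℂ) (W : Matrix n n ℂ) :
    matInner (outer a) W = (star a ⬝ᵥ W.mulVec a).re := by
  simp only [matInner, outer, Matrix.conjTranspose_vecMulVec, star_star, Matrix.trace, Matrix.diag,
    Matrix.mul_apply, Matrix.vecMulVec_apply, dotProduct, Matrix.mulVec, Pi.star_apply,
    Finset.mul_sum]
  rw [Finset.sum_comm]
  congr 1
  refine Finset.sum_congr rfl fun i _ => Finset.sum_congr rfl fun j _ => by ring

lemma matInner_outer_right (w : n → ℂ) (A : Matrix n n ℂ) (hA : A.IsHermitian) :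
    matInner A (outer w) = (star w ⬝ᵥ A.mulVec w).re := by
  simp only [matInner, outer, hA.eq, Matrix.trace, Matrix.diag,
    Matrix.mul_apply, Matrix.vecMulVec_apply, dotProduct, Matrix.mulVec, Pi.star_apply,
    Finset.mul_sum]
  congr 1
  refine Finset.sum_congr rfl fun i _ => Finset.sum_congr rfl fun j _ => by ring

lemma outer_mulVec (w a : n → ℂ) : (outer w).mulVec a = (star w ⬝ᵥ a) • w := by
  ext i
  simp only [outer, Matrix.mulVec, dotProduct, Matrix.vecMulVec_apply, Pi.smul_apply, smul_eq_mul,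
    Finset.sum_mul]
  exact Finset.sum_congr rfl fun j _ => by ring

lemma matInner_outer_outer (a w : n → ℂ) :
    matInner (outer a) (outer w) = Complex.normSq (star a ⬝ᵥ w) := by
  have h : star w ⬝ᵥ a = conj (star a ⬝ᵥ w) := by
    simp [dotProduct, map_sum, mul_comm]
  rw [matInner_outer_left, outer_mulVec, dotProduct_smul, smul_eq_mul, h,
    ← Complex.normSq_eq_conj_mul_self, Complex.ofReal_re]

lemma posSemidef_outer (w : n → ℂ) : (outer w).PosSemidef :=
  Matrix.posSemidef_vecMulVec_self_star w

/-- Factor A = Bᴴ B and take the conjugated rows of B. This turns A • ξξᴴ into the squared norm of a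
linear image of ξ, which is again circular Gaussian when ξ is. -/
lemma Matrix.PosSemidef.exists_eq_sum_outer {A : Matrix n n ℂ} (hA : A.PosSemidef) :
    ∃ d : n → n → ℂ, A = ∑ i, outer (d i) := by
  classical
  obtain ⟨B, rfl⟩ : ∃ B : Matrix n n ℂ, A = B.conjTranspose * B := by
    open scoped MatrixOrder in
    exact CStarAlgebra.nonneg_iff_eq_star_mul_self.mp hA.nonneg
  refine ⟨fun i => star (B i), ?_⟩
  ext p q
  simp [Matrix.mul_apply, Matrix.sum_apply, outer, Matrix.vecMulVec_apply]

lemma matInner_nonneg {A W : Matrix n n ℂ} (hA : A.PosSemidef) (hW : W.PosSemidef) :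
    0 ≤ matInner A W := by
  obtain ⟨d, rfl⟩ := hA.exists_eq_sum_outer
  rw [matInner_sum_left]
  refine Finset.sum_nonneg fun i _ => ?_
  rw [matInner_outer_left]
  exact (Complex.le_def.mp (hW.dotProduct_mulVec_nonneg (d i))).1

lemma matInner_le_matInner {A B W : Matrix n n ℂ} (h : (B - A).PosSemidef) (hW : W.PosSemidef) :
    matInner A W ≤ matInner B W := by
  have := matInner_nonneg h hW
  rw [matInner_sub_left] at this
  linarith

lemma rank_outer_le_one (w : n → ℂ) : (outer w).rank ≤ 1 :=
  Matrix.rank_vecMulVec_le w (star w)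

lemma outer_smul {n : Type*} (c : ℂ) (w : n → ℂ) : outer (c • w) = ((Complex.normSq c : ℝ) : ℂ) • outer w := by
  ext i j
  simp only [outer, Matrix.vecMulVec_apply, Pi.smul_apply, Pi.star_apply, smul_eq_mul, star_mul',
    Matrix.smul_apply, Complex.normSq_eq_conj_mul_self, RCLike.star_def]
  ring

/-- A positive semidefinite matrix of rank at most one is of the form `w wᴴ`. -/
lemma Matrix.PosSemidef.exists_eq_outer_of_rank_le_one {W : Matrix n n ℂ} (hW : W.PosSemidef)
    (h : W.rank ≤ 1) : ∃ w, W = outer w := by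
  classical
  obtain ⟨v, hv⟩ := (finrank_le_one_iff (K := ℂ) (V := LinearMap.range W.mulVecLin)).mp h
  have hcol : ∀ j, ∃ c : ℂ, ∀ i, W i j = c * v.1 i := by
    intro j
    obtain ⟨c, hc⟩ := hv ⟨W.mulVecLin (Pi.single j 1), LinearMap.mem_range_self _ _⟩
    refine ⟨c, fun i => ?_⟩
    have := congrFun (congrArg Subtype.val hc) i
    simpa using this.symm
  choose c hc using hcol
  by_cases h0 : W.trace = 0
  · exact ⟨0, by rw [hW.trace_eq_zero_iff.mp h0]; ext; simp [outer, Matrix.vecMulVec_apply]⟩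
  obtain ⟨p, hp⟩ : ∃ p, W p p ≠ 0 := by
    by_contra! hcon
    exact h0 (by simp [Matrix.trace, hcon])
  obtain ⟨r, hr, hrW⟩ : ∃ r : ℝ, 0 ≤ r ∧ W p p = r := by
    obtain ⟨h1, h2⟩ := Complex.le_def.mp (hW.diag_nonneg (i := p))
    exact ⟨(W p p).re, h1, Complex.ext rfl h2.symm⟩
  -- Rank one makes W proportional to the outer square of any of its columns; dividing the column by
  -- √(W p p) fixes the scale.
  refine ⟨fun i => W i p / (Real.sqrt r : ℝ), ?_⟩
  ext i j
  have hj : star (W j p) = W p j := hW.isHermitian.apply p j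
  have hs : ((Real.sqrt r : ℝ) : ℂ) * (Real.sqrt r : ℝ) = W p p := by
    rw [← Complex.ofReal_mul, Real.mul_self_sqrt hr, hrW]
  simp only [outer, Matrix.vecMulVec_apply, Pi.star_apply, star_div₀, hj]
  rw [RCLike.star_def, Complex.conj_ofReal, div_mul_div_comm, hs, eq_div_iff hp, hc j i, hc p p,
    hc p i, hc j p]
  ring

end MatInner

/-! ### Circularly symmetric Gaussian vectors: linear images, real moments, independence. -/

lemma measurable_complex_of_re_im (l : Type*) :
    Measurable (fun (x : l × Bool → ℝ) i => (⟨x (i, true), x (i, false)⟩ : ℂ)) := by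
  refine measurable_pi_lambda _ fun i => ?_
  exact Complex.measurableEquivRealProd.symm.measurable.comp (by fun_prop :
    Measurable fun x : l × Bool → ℝ => (x (i, true), x (i, false)))

namespace IsCircularGaussian

variable {Ω : Type*} [MeasurableSpace Ω] {n m k : Type*} [Fintype n] [Fintype m] [Fintype k]
  {ξ : Ω → n → ℂ} {W : Matrix n n ℂ} {μ : Measure Ω}

lemma hasGaussianLaw_coord (h : IsCircularGaussian ξ W μ) (i : n) :
    HasGaussianLaw (fun ω => ξ ω i) μ :=
  h.gaussian.map_fun (ContinuousLinearMap.proj (R := ℝ) (φ := fun _ : n => ℂ) i)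

lemma memLp_coord (h : IsCircularGaussian ξ W μ) (i : n) : MemLp (fun ω => ξ ω i) 2 μ :=
  (h.hasGaussianLaw_coord i).memLp_two

lemma memLp_conj (h : IsCircularGaussian ξ W μ) (i : n) : MemLp (fun ω => conj (ξ ω i)) 2 μ :=
  (h.memLp_coord i).star

lemma integrable_mul (h : IsCircularGaussian ξ W μ) (i j : n) :
    Integrable (fun ω => ξ ω i * ξ ω j) μ :=
  (h.memLp_coord i).integrable_mul (h.memLp_coord j)

lemma integrable_mul_conj (h : IsCircularGaussian ξ W μ) (i j : n) :
    Integrable (fun ω => ξ ω i * conj (ξ ω j)) μ :=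
  (h.memLp_coord i).integrable_mul (h.memLp_conj j)

/-- Circularly symmetric Gaussian vectors are stable under complex linear maps. -/
lemma mulVec (h : IsCircularGaussian ξ W μ) (B : Matrix m n ℂ) :
    IsCircularGaussian (fun ω => B.mulVec (ξ ω)) (B * W * B.conjTranspose) μ where
  gaussian := h.gaussian.map_fun
    (LinearMap.toContinuousLinearMap (B.mulVecLin.restrictScalars ℝ))
  mean i := by
    simp only [Matrix.mulVec, dotProduct]
    rw [integral_finsetSum _ fun j _ => ((h.hasGaussianLaw_coord j).integrable).const_mul _]
    simp [integral_const_mul, h.mean]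
  cov i j := by
    simp only [Matrix.mulVec, dotProduct, map_sum, map_mul, Matrix.mul_apply,
      Matrix.conjTranspose_apply, Finset.sum_mul, Finset.mul_sum, RCLike.star_def]
    have hi : ∀ p q, Integrable (fun ω => B i p * ξ ω p * (conj (B j q) * conj (ξ ω q))) μ :=
      fun p q => ((h.integrable_mul_conj p q).const_mul (B i p * conj (B j q))).congr
        (.of_forall fun ω => by ring)
    rw [integral_finsetSum _ fun q _ => integrable_finsetSum _ fun p _ => hi p q]
    refine Finset.sum_congr rfl fun q _ => ?_
    rw [integral_finsetSum _ fun p _ => hi p q]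
    refine Finset.sum_congr rfl fun p _ => ?_
    rw [← h.cov p q, mul_right_comm, ← integral_const_mul]
    exact integral_congr_ae (.of_forall fun ω => by ring)
  pseudoCov i j := by
    simp only [Matrix.mulVec, dotProduct, Finset.sum_mul_sum]
    have hi : ∀ p q, Integrable (fun ω => B i p * ξ ω p * (B j q * ξ ω q)) μ :=
      fun p q => ((h.integrable_mul p q).const_mul (B i p * B j q)).congr
        (.of_forall fun ω => by ring)
    rw [integral_finsetSum _ fun p _ => integrable_finsetSum _ fun q _ => hi p q]
    refine Finset.sum_eq_zero fun p _ => ?_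
    rw [integral_finsetSum _ fun q _ => hi p q]
    refine Finset.sum_eq_zero fun q _ => ?_
    rw [show (fun ω => B i p * ξ ω p * (B j q * ξ ω q)) =
      fun ω => B i p * B j q * (ξ ω p * ξ ω q) from funext fun ω => by ring, integral_const_mul,
      h.pseudoCov, mul_zero]

/-- The identity 2 Re x Re y = Re(x ȳ) + Re(x y) expresses the moment by covariance and
pseudo-covariance, and the latter vanishes. The next three lemmas use the analogous identities. -/
lemma integral_re_mul_re (h : IsCircularGaussian ξ W μ) (i j : n) :
    ∫ ω, (ξ ω i).re * (ξ ω j).re ∂μ = (W i j).re / 2 := by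
  have h1 := integral_re (h.integrable_mul_conj i j)
  have h2 := integral_re (h.integrable_mul i j)
  rw [h.cov] at h1
  rw [h.pseudoCov] at h2
  have := integral_add (h.integrable_mul_conj i j).re (h.integrable_mul i j).re
  rw [h1, h2] at this
  simp at this
  rw [← this, ← integral_div]
  exact integral_congr_ae (.of_forall fun ω => by simp)

lemma integral_im_mul_im (h : IsCircularGaussian ξ W μ) (i j : n) :
    ∫ ω, (ξ ω i).im * (ξ ω j).im ∂μ = (W i j).re / 2 := by
  have h1 := integral_re (h.integrable_mul_conj i j)
  have h2 := integral_re (h.integrable_mul i j)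
  rw [h.cov] at h1
  rw [h.pseudoCov] at h2
  have := integral_sub (h.integrable_mul_conj i j).re (h.integrable_mul i j).re
  rw [h1, h2] at this
  simp at this
  rw [← this, ← integral_div]
  exact integral_congr_ae (.of_forall fun ω => by simp)

lemma integral_re_mul_im (h : IsCircularGaussian ξ W μ) (i j : n) :
    ∫ ω, (ξ ω i).re * (ξ ω j).im ∂μ = - (W i j).im / 2 := by
  have h1 := integral_im (h.integrable_mul_conj i j)
  have h2 := integral_im (h.integrable_mul i j)
  rw [h.cov] at h1
  rw [h.pseudoCov] at h2
  have := integral_sub (h.integrable_mul i j).im (h.integrable_mul_conj i j).im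
  rw [h1, h2] at this
  simp at this
  rw [← this, ← integral_div]
  exact integral_congr_ae (.of_forall fun ω => by simp)

lemma integral_im_mul_re (h : IsCircularGaussian ξ W μ) (i j : n) :
    ∫ ω, (ξ ω i).im * (ξ ω j).re ∂μ = (W i j).im / 2 := by
  have h1 := integral_im (h.integrable_mul_conj i j)
  have h2 := integral_im (h.integrable_mul i j)
  rw [h.cov] at h1
  rw [h.pseudoCov] at h2
  have := integral_add (h.integrable_mul_conj i j).im (h.integrable_mul i j).im
  rw [h1, h2] at this
  simp at this
  rw [← this, ← integral_div]
  exact integral_congr_ae (.of_forall fun ω => by simp; ring)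

lemma hasGaussianLaw_re (h : IsCircularGaussian ξ W μ) (i : n) :
    HasGaussianLaw (fun ω => (ξ ω i).re) μ :=
  (h.hasGaussianLaw_coord i).map_fun Complex.reCLM

lemma hasGaussianLaw_im (h : IsCircularGaussian ξ W μ) (i : n) :
    HasGaussianLaw (fun ω => (ξ ω i).im) μ :=
  (h.hasGaussianLaw_coord i).map_fun Complex.imCLM

lemma integral_re (h : IsCircularGaussian ξ W μ) (i : n) : ∫ ω, (ξ ω i).re ∂μ = 0 := by
  have := _root_.integral_re (h.hasGaussianLaw_coord i).integrable
  rw [h.mean] at this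
  simpa using this

lemma integral_im (h : IsCircularGaussian ξ W μ) (i : n) : ∫ ω, (ξ ω i).im ∂μ = 0 := by
  have := _root_.integral_im (h.hasGaussianLaw_coord i).integrable
  rw [h.mean] at this
  simpa using this

lemma map_re (h : IsCircularGaussian ξ W μ) (i : n) :
    μ.map (fun ω => (ξ ω i).re) = gaussianReal 0 ((W i i).re / 2).toNNReal := by
  have := h.gaussian.isProbabilityMeasure
  rw [(h.hasGaussianLaw_re i).map_eq_gaussianReal, h.integral_re, variance_eq_sub
    (h.hasGaussianLaw_re i).memLp_two, h.integral_re]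
  simp [pow_two, h.integral_re_mul_re]

lemma map_im (h : IsCircularGaussian ξ W μ) (i : n) :
    μ.map (fun ω => (ξ ω i).im) = gaussianReal 0 ((W i i).re / 2).toNNReal := by
  have := h.gaussian.isProbabilityMeasure
  rw [(h.hasGaussianLaw_im i).map_eq_gaussianReal, h.integral_im, variance_eq_sub
    (h.hasGaussianLaw_im i).memLp_two, h.integral_im]
  simp [pow_two, h.integral_im_mul_im]

/-- Uncorrelated complex linear images of a circularly symmetric Gaussian vector are
independent. -/
lemma indepFun_mulVec (h : IsCircularGaussian ξ W μ) (B : Matrix m n ℂ) (C : Matrix k n ℂ)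
    (hBC : B * W * C.conjTranspose = 0) :
    IndepFun (fun ω => B.mulVec (ξ ω)) (fun ω => C.mulVec (ξ ω)) μ := by
  have := h.gaussian.isProbabilityMeasure
  -- Stacking the two images gives one jointly Gaussian vector whose off-diagonal covariance block
  -- is zero. Its pseudo-covariance is zero as well, so all four real cross-covariances vanish, and
  -- uncorrelated jointly Gaussian vectors are independent.
  have hη := h.mulVec (Matrix.fromRows B C)
  set η : Ω → m ⊕ k → ℂ := fun ω => (Matrix.fromRows B C).mulVec (ξ ω) with hηdef
  have hzero : ∀ i j, (Matrix.fromRows B C * W * (Matrix.fromRows B C).conjTranspose)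
      (Sum.inl i) (Sum.inr j) = 0 := by
    intro i j
    have := congrFun (congrFun hBC i) j
    simpa [Matrix.mul_apply] using this
  set V := Matrix.fromRows B C * W * (Matrix.fromRows B C).conjTranspose
  -- The index `true` selects real parts and `false` imaginary parts.
  let pr (b : Bool) : ℂ →L[ℝ] ℝ := if b then Complex.reCLM else Complex.imCLM
  have hind : IndepFun (fun ω (p : m × Bool) => pr p.2 (η ω (Sum.inl p.1)))
      (fun ω (p : k × Bool) => pr p.2 (η ω (Sum.inr p.1))) μ := by
    refine HasGaussianLaw.indepFun_of_covariance_eval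
      (X := fun (p : m × Bool) ω => pr p.2 (η ω (Sum.inl p.1)))
      (Y := fun (p : k × Bool) ω => pr p.2 (η ω (Sum.inr p.1))) ?_ ?_
    · exact hη.gaussian.map_fun (ContinuousLinearMap.prod
        (ContinuousLinearMap.pi fun p : m × Bool => (pr p.2).comp
          (ContinuousLinearMap.proj (R := ℝ) (φ := fun _ : m ⊕ k => ℂ) (Sum.inl p.1)))
        (ContinuousLinearMap.pi fun p : k × Bool => (pr p.2).comp
          (ContinuousLinearMap.proj (R := ℝ) (φ := fun _ : m ⊕ k => ℂ) (Sum.inr p.1))))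
    · rintro ⟨i, b⟩ ⟨j, c⟩
      have hb : ∀ (b : Bool) q, MemLp (fun ω => pr b (η ω q)) 2 μ ∧ ∫ ω, pr b (η ω q) ∂μ = 0 := by
        intro b q
        cases b
        · exact ⟨(hη.hasGaussianLaw_im q).memLp_two, hη.integral_im q⟩
        · exact ⟨(hη.hasGaussianLaw_re q).memLp_two, hη.integral_re q⟩
      rw [covariance_eq_sub (hb b _).1 (hb c _).1, (hb b _).2, zero_mul, sub_zero]
      cases b <;> cases c
      · exact (hη.integral_im_mul_im _ _).trans (by rw [hzero]; simp)
      · exact (hη.integral_im_mul_re _ _).trans (by rw [hzero]; simp)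
      · exact (hη.integral_re_mul_im _ _).trans (by rw [hzero]; simp)
      · exact (hη.integral_re_mul_re _ _).trans (by rw [hzero]; simp)
  have hB : (fun ω => B.mulVec (ξ ω)) = (fun (x : m × Bool → ℝ) i => (⟨x (i, true), x (i, false)⟩ : ℂ)) ∘
      (fun ω (p : m × Bool) => pr p.2 (η ω (Sum.inl p.1))) := by
    ext ω i
    simp [pr, η, Matrix.fromRows_mulVec]
  have hC : (fun ω => C.mulVec (ξ ω)) = (fun (x : k × Bool → ℝ) i => (⟨x (i, true), x (i, false)⟩ : ℂ)) ∘
      (fun ω (p : k × Bool) => pr p.2 (η ω (Sum.inr p.1))) := by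
    ext ω i
    simp [pr, η, Matrix.fromRows_mulVec]
  rw [hB, hC]
  exact hind.comp (measurable_complex_of_re_im m) (measurable_complex_of_re_im k)

lemma indepFun_re_im (h : IsCircularGaussian ξ W μ) (i : n) (hi : (W i i).im = 0) :
    IndepFun (fun ω => (ξ ω i).re) (fun ω => (ξ ω i).im) μ := by
  have := h.gaussian.isProbabilityMeasure
  refine HasGaussianLaw.indepFun_of_covariance_eq_zero
    ((h.hasGaussianLaw_coord i).map_fun (Complex.reCLM.prod Complex.imCLM)) ?_
  rw [covariance_eq_sub (h.hasGaussianLaw_re i).memLp_two (h.hasGaussianLaw_im i).memLp_two,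
    h.integral_re, zero_mul, sub_zero]
  exact (h.integral_re_mul_im i i).trans (by simp [hi])

end IsCircularGaussian

/-! ### Exponential moments and small-ball estimates for Gaussians. -/

lemma gaussianPDFReal_le (μ : ℝ) (v : NNReal) (x : ℝ) :
    gaussianPDFReal μ v x ≤ (Real.sqrt (2 * Real.pi * v))⁻¹ := by
  rw [gaussianPDFReal]
  refine mul_le_of_le_one_right (by positivity) (Real.exp_le_one_iff.mpr ?_)
  rw [neg_div]
  exact neg_nonpos.mpr (by positivity)

lemma gaussianReal_le_smul_volume (μ : ℝ) {v : NNReal} (hv : v ≠ 0) (s : Set ℝ) :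
    gaussianReal μ v s ≤ ENNReal.ofReal (Real.sqrt (2 * Real.pi * v))⁻¹ * volume s := by
  rw [gaussianReal_apply μ hv, ← setLIntegral_const]
  exact lintegral_mono fun x => ENNReal.ofReal_le_ofReal (gaussianPDFReal_le μ v x)

/-- The exponential square moment `E exp (X² / (4v)) = √2` of a centred real Gaussian. -/
lemma lintegral_exp_sq_gaussianReal {v : NNReal} (hv : v ≠ 0) :
    ∫⁻ x, ENNReal.ofReal (Real.exp (x ^ 2 / (4 * v))) ∂(gaussianReal 0 v)
      = ENNReal.ofReal (Real.sqrt 2) := by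
  have hv' : (0 : ℝ) < v := by positivity
  rw [gaussianReal_of_var_ne_zero 0 hv, lintegral_withDensity_eq_lintegral_mul _
    (measurable_gaussianPDF 0 v) (by fun_prop)]
  -- Multiplying the density of variance v by exp(x²/(4v)) gives √2 times the density of variance
  -- 2v.
  have hpt : ∀ x : ℝ, (gaussianPDF 0 v * fun x : ℝ => ENNReal.ofReal (Real.exp (x ^ 2 / (4 * v)))) x
      = ENNReal.ofReal (Real.sqrt 2) * gaussianPDF 0 (2 * v) x := by
    intro x
    simp only [Pi.mul_apply, gaussianPDF]
    rw [← ENNReal.ofReal_mul (gaussianPDFReal_nonneg _ _ _), ← ENNReal.ofReal_mul (by positivity)]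
    congr 1
    simp only [gaussianPDFReal, NNReal.coe_mul, NNReal.coe_ofNat, sub_zero]
    rw [mul_assoc, ← Real.exp_add, show 2 * Real.pi * (2 * (v : ℝ)) = 2 * (2 * Real.pi * v) by ring,
      Real.sqrt_mul (by norm_num) (2 * Real.pi * v)]
    have h2 : Real.sqrt 2 ≠ 0 := by positivity
    have he : -x ^ 2 / (2 * (v : ℝ)) + x ^ 2 / (4 * v) = -x ^ 2 / (2 * (2 * v)) := by
      field_simp; ring
    rw [he, mul_inv, mul_assoc, ← mul_assoc (Real.sqrt 2), mul_inv_cancel_left₀ h2]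
  rw [lintegral_congr hpt, lintegral_const_mul _ (measurable_gaussianPDF 0 _),
    lintegral_gaussianPDF_eq_one 0 (by simpa using hv), mul_one]

namespace IsCircularGaussian

variable {Ω : Type*} [MeasurableSpace Ω] {n m k : Type*} [Fintype n] [Fintype m] [Fintype k]
  {ξ : Ω → n → ℂ} {W : Matrix n n ℂ} {μ : Measure Ω}

lemma cov_diag (h : IsCircularGaussian ξ W μ) (i : n) :
    W i i = ((∫ ω, Complex.normSq (ξ ω i) ∂μ : ℝ) : ℂ) := by
  rw [← h.cov, ← integral_complex_ofReal]
  exact integral_congr_ae (.of_forall fun ω => by simp [Complex.mul_conj])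

lemma integrable_normSq (h : IsCircularGaussian ξ W μ) (i : n) :
    Integrable (fun ω => Complex.normSq (ξ ω i)) μ := by
  simpa [Complex.mul_conj] using (h.integrable_mul_conj i i).re

/-- Real and imaginary part are independent with half the variance each, and each contributes a
factor √2. -/
lemma lintegral_exp_normSq (h : IsCircularGaussian ξ W μ) (i : n) (hi : 0 < (W i i).re) :
    ∫⁻ ω, ENNReal.ofReal (Real.exp (Complex.normSq (ξ ω i) / (2 * (W i i).re))) ∂μ = 2 := by
  have hv : ((W i i).re / 2).toNNReal ≠ 0 := by simpa using hi
  have hv' : ((((W i i).re / 2).toNNReal : NNReal) : ℝ) = (W i i).re / 2 :=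
    Real.coe_toNNReal _ (by positivity)
  set v := ((W i i).re / 2).toNNReal
  let F : ℝ → ENNReal := fun x => ENNReal.ofReal (Real.exp (x ^ 2 / (4 * v)))
  have hF : Measurable F := by fun_prop
  have hre := (h.hasGaussianLaw_re i).aemeasurable
  have him := (h.hasGaussianLaw_im i).aemeasurable
  have hind := (h.indepFun_re_im i (by rw [h.cov_diag i, Complex.ofReal_im])).comp hF hF
  have h1 : ∫⁻ ω, F (ξ ω i).re ∂μ = ENNReal.ofReal (Real.sqrt 2) := by
    rw [← lintegral_exp_sq_gaussianReal hv, ← h.map_re i, lintegral_map' hF.aemeasurable hre]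
  have h2 : ∫⁻ ω, F (ξ ω i).im ∂μ = ENNReal.ofReal (Real.sqrt 2) := by
    rw [← lintegral_exp_sq_gaussianReal hv, ← h.map_im i, lintegral_map' hF.aemeasurable him]
  have := lintegral_mul_eq_lintegral_mul_lintegral_of_indepFun'' (hF.comp_aemeasurable hre)
    (hF.comp_aemeasurable him) hind
  simp only [Function.comp_apply] at this
  rw [h1, h2, ← ENNReal.ofReal_mul (by positivity), Real.mul_self_sqrt (by norm_num)] at this
  rw [← ENNReal.ofReal_ofNat, ← this]
  refine lintegral_congr fun ω => ?_
  simp only [F]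
  rw [← ENNReal.ofReal_mul (by positivity), ← Real.exp_add, hv', Complex.normSq_apply]
  congr 2
  field_simp
  ring

/-- The planar density is at most 1/(πτ) with τ = W i i, and the disc |z|² ≤ y has area πy. -/
lemma map_coord_normSq_le (h : IsCircularGaussian ξ W μ) (i : n) (hi : 0 < (W i i).re) (y : ℝ) :
    μ.map (fun ω => ξ ω i) {z | Complex.normSq z ≤ y} ≤ ENNReal.ofReal (y / (W i i).re) := by
  have hP := h.gaussian.isProbabilityMeasure
  have hv : ((W i i).re / 2).toNNReal ≠ 0 := by simpa using hi
  have hv' : ((((W i i).re / 2).toNNReal : NNReal) : ℝ) = (W i i).re / 2 :=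
    Real.coe_toNNReal _ (by positivity)
  set v := ((W i i).re / 2).toNNReal
  set τ := (W i i).re
  have hre := (h.hasGaussianLaw_re i).aemeasurable
  have him := (h.hasGaussianLaw_im i).aemeasurable
  rcases lt_or_ge y 0 with hy | hy
  · have : {z : ℂ | Complex.normSq z ≤ y} = ∅ := by
      ext z
      simp only [Set.mem_ofPred_eq, Set.mem_empty_iff_false, iff_false, not_le]
      exact hy.trans_le (Complex.normSq_nonneg z)
    simp [this]
  have hS : {z : ℂ | Complex.normSq z ≤ y} = Metric.closedBall 0 (Real.sqrt y) := by
    ext z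
    rw [Set.mem_ofPred_eq, mem_closedBall_zero_iff, Complex.normSq_eq_norm_sq,
      Real.le_sqrt (norm_nonneg _) hy]
  have hSm : MeasurableSet {z : ℂ | Complex.normSq z ≤ y} := by
    rw [hS]; exact Metric.isClosed_closedBall.measurableSet
  set e := Complex.measurableEquivRealProd
  set T : Set (ℝ × ℝ) := e.symm ⁻¹' {z : ℂ | Complex.normSq z ≤ y} with hT
  have hTm : MeasurableSet T := e.symm.measurable hSm
  have hmap := (h.indepFun_re_im i (by rw [h.cov_diag i, Complex.ofReal_im])).map_prod_eq_prod_map_map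
    hre him
  rw [h.map_re, h.map_im] at hmap
  have hT' : (fun ω => ξ ω i) ⁻¹' {z | Complex.normSq z ≤ y} =
      (fun ω => ((ξ ω i).re, (ξ ω i).im)) ⁻¹' T := rfl
  set c := ENNReal.ofReal (Real.sqrt (2 * Real.pi * v))⁻¹
  have hvol : volume T = ENNReal.ofReal y * ENNReal.ofReal Real.pi := by
    rw [hT, Complex.volume_preserving_equiv_real_prod.symm.measure_preimage hSm.nullMeasurableSet,
      hS, Complex.volume_closedBall, ← ENNReal.ofReal_pow (Real.sqrt_nonneg _), Real.sq_sqrt hy]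
    congr 1
    rw [← NNReal.coe_real_pi, ENNReal.ofReal_coe_nnreal]
  rw [Measure.map_apply_of_aemeasurable (h.hasGaussianLaw_coord i).aemeasurable hSm, hT',
    ← Measure.map_apply_of_aemeasurable (hre.prodMk him) hTm, hmap, Measure.prod_apply hTm]
  calc ∫⁻ x, gaussianReal 0 v (Prod.mk x ⁻¹' T) ∂gaussianReal 0 v
      ≤ ∫⁻ x, c * volume (Prod.mk x ⁻¹' T) ∂gaussianReal 0 v :=
        lintegral_mono fun x => gaussianReal_le_smul_volume 0 hv _
    _ = c * ∫⁻ x, volume (Prod.mk x ⁻¹' T) ∂gaussianReal 0 v :=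
        lintegral_const_mul _ (measurable_measure_prodMk_left hTm)
    _ ≤ c * ∫⁻ x, volume (Prod.mk x ⁻¹' T) ∂(c • volume) := by
        gcongr
        refine Measure.le_iff.mpr fun s _ => ?_
        rw [Measure.smul_apply, smul_eq_mul]
        exact gaussianReal_le_smul_volume 0 hv s
    _ = c * c * volume T := by
        rw [lintegral_smul_measure, Measure.volume_eq_prod, Measure.prod_apply hTm, smul_eq_mul,
          mul_assoc]
    _ = ENNReal.ofReal (y / τ) := by
        rw [hvol, ← ENNReal.ofReal_mul (by positivity), ← ENNReal.ofReal_mul hy,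
          ← ENNReal.ofReal_mul (by positivity), ← mul_inv, Real.mul_self_sqrt (by positivity), hv']
        congr 1
        have := Real.pi_pos
        field_simp

/-- Exponential square moment of a circularly symmetric Gaussian vector. -/
lemma lintegral_exp_sum_normSq_le (h : IsCircularGaussian ξ W μ) (hpos : 0 < ∑ i, (W i i).re) :
    ∫⁻ ω, ENNReal.ofReal (Real.exp ((∑ i, Complex.normSq (ξ ω i)) / (2 * ∑ i, (W i i).re))) ∂μ
      ≤ 2 := by
  set T := ∑ i, (W i i).re with hT
  have hnn : ∀ i, 0 ≤ (W i i).re := fun i => by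
    rw [h.cov_diag i, Complex.ofReal_re]
    exact integral_nonneg fun ω => Complex.normSq_nonneg _
  -- Coordinates of variance zero get weight zero in the Jensen step below; nothing is lost because
  -- they vanish almost surely.
  have hzero : ∀ᵐ ω ∂μ, ∀ i, (W i i).re = 0 → Complex.normSq (ξ ω i) = 0 := by
    rw [ae_all_iff]
    intro i
    by_cases hi : (W i i).re = 0
    · have h0 : ∫ ω, Complex.normSq (ξ ω i) ∂μ = 0 := by
        rw [h.cov_diag i, Complex.ofReal_re] at hi
        exact hi
      rw [integral_eq_zero_iff_of_nonneg (fun ω => Complex.normSq_nonneg _)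
        (h.integrable_normSq i)] at h0
      filter_upwards [h0] with ω hω _ using hω
    · exact .of_forall fun ω h' => absurd h' hi
  have hw : ∑ i, (W i i).re / T = 1 := by rw [← Finset.sum_div, ← hT, div_self hpos.ne']
  have hpt : ∀ᵐ ω ∂μ, ENNReal.ofReal (Real.exp ((∑ i, Complex.normSq (ξ ω i)) / (2 * T))) ≤
      ∑ i, ENNReal.ofReal ((W i i).re / T) *
        ENNReal.ofReal (Real.exp (Complex.normSq (ξ ω i) / (2 * (W i i).re))) := by
    filter_upwards [hzero] with ω hω
    -- The coordinates may be correlated, so the exponential is not factored. Jensen with weights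
    -- proportional to the variances reduces the claim to single coordinates.
    have hJ := convexOn_exp.map_sum_le (t := Finset.univ) (w := fun i => (W i i).re / T)
      (p := fun i => Complex.normSq (ξ ω i) / (2 * (W i i).re))
      (fun i _ => div_nonneg (hnn i) hpos.le) hw (fun i _ => Set.mem_univ _)
    have hs : ∑ i, ((W i i).re / T) • (Complex.normSq (ξ ω i) / (2 * (W i i).re)) =
        (∑ i, Complex.normSq (ξ ω i)) / (2 * T) := by
      rw [Finset.sum_div]
      refine Finset.sum_congr rfl fun i _ => ?_
      by_cases hi : (W i i).re = 0
      · simp [hω i hi]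
      · rw [smul_eq_mul]
        field_simp
    rw [hs] at hJ
    refine (ENNReal.ofReal_le_ofReal hJ).trans ?_
    rw [ENNReal.ofReal_sum_of_nonneg fun i _ => smul_nonneg (div_nonneg (hnn i) hpos.le)
      (Real.exp_nonneg _)]
    exact Finset.sum_le_sum fun i _ => by
      rw [smul_eq_mul, ENNReal.ofReal_mul (div_nonneg (hnn i) hpos.le)]
  have hmeas : ∀ i, AEMeasurable (fun ω => ENNReal.ofReal
      (Real.exp (Complex.normSq (ξ ω i) / (2 * (W i i).re)))) μ := fun i =>
    (((Complex.continuous_normSq.measurable.comp_aemeasurable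
      (h.hasGaussianLaw_coord i).aemeasurable).div_const _).exp).ennreal_ofReal
  calc _ ≤ _ := lintegral_mono_ae hpt
    _ = ∑ i, ENNReal.ofReal ((W i i).re / T) * ∫⁻ ω, ENNReal.ofReal
          (Real.exp (Complex.normSq (ξ ω i) / (2 * (W i i).re))) ∂μ := by
        rw [lintegral_finsetSum' _ fun i _ => (hmeas i).const_mul _]
        exact Finset.sum_congr rfl fun i _ => lintegral_const_mul'' _ (hmeas i)
    _ ≤ ∑ i, ENNReal.ofReal ((W i i).re / T) * 2 := by
        refine Finset.sum_le_sum fun i _ => ?_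
        rcases (hnn i).eq_or_lt with hi | hi
        · simp [← hi]
        · rw [h.lintegral_exp_normSq i hi]
    _ = 2 := by
        rw [← Finset.sum_mul, ← ENNReal.ofReal_sum_of_nonneg fun i _ => div_nonneg (hnn i) hpos.le,
          hw, ENNReal.ofReal_one, one_mul]

end IsCircularGaussian

/-! ### Quadratic forms of Gaussian vectors: upper tails and comparison of two forms. -/

section QuadraticForms

variable {n : Type*} [Fintype n]

lemma Complex.normSq_add_le_two_mul (x y : ℂ) :
    Complex.normSq (x + y) ≤ 2 * Complex.normSq x + 2 * Complex.normSq y := by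
  simp only [Complex.normSq_apply, Complex.add_re, Complex.add_im]
  nlinarith [sq_nonneg (x.re - y.re), sq_nonneg (x.im - y.im)]

lemma matInner_outer_add_le {C : Matrix n n ℂ} (hC : C.PosSemidef) (x y : n → ℂ) :
    matInner C (outer (x + y)) ≤ 2 * matInner C (outer x) + 2 * matInner C (outer y) := by
  obtain ⟨d, rfl⟩ := hC.exists_eq_sum_outer
  simp only [matInner_sum_left, matInner_outer_outer, dotProduct_add]
  rw [Finset.mul_sum, Finset.mul_sum, ← Finset.sum_add_distrib]
  exact Finset.sum_le_sum fun i _ => Complex.normSq_add_le_two_mul _ _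

lemma matInner_outer_smul (C : Matrix n n ℂ) (c : ℂ) (x : n → ℂ) :
    matInner C (outer (c • x)) = Complex.normSq c * matInner C (outer x) := by
  rw [outer_smul]
  simp [matInner]

lemma continuous_matInner_outer (C : Matrix n n ℂ) :
    Continuous fun x : n → ℂ => matInner C (outer x) := by
  unfold matInner outer
  simp only [Matrix.trace, Matrix.diag, Matrix.mul_apply, Matrix.vecMulVec_apply, Pi.star_apply]
  fun_prop

end QuadraticForms

/-- If `S` is independent of `Y` and the law of `|S|²` has density at most `1 / τ`, then
`P(|S|² ≤ Z(Y)) ≤ E[Z(Y)] / τ`. -/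
lemma measure_normSq_le_of_indepFun {Ω β : Type*} [MeasurableSpace Ω] [MeasurableSpace β]
    {μ : Measure Ω} [IsProbabilityMeasure μ] {S : Ω → ℂ} {Y : Ω → β} (hS : AEMeasurable S μ)
    (hY : AEMeasurable Y μ) (hind : IndepFun S Y μ) {τ : ℝ}
    (hball : ∀ y : ℝ, μ.map S {z | Complex.normSq z ≤ y} ≤ ENNReal.ofReal (y / τ))
    {Z : β → ℝ} (hZ : Measurable Z) :
    μ {ω | Complex.normSq (S ω) ≤ Z (Y ω)} ≤ ∫⁻ ω, ENNReal.ofReal (Z (Y ω) / τ) ∂μ := by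
  have hT : MeasurableSet {p : β × ℂ | Complex.normSq p.2 ≤ Z p.1} :=
    measurableSet_le (Complex.continuous_normSq.measurable.comp measurable_snd)
      (hZ.comp measurable_fst)
  have hmap := hind.symm.map_prod_eq_prod_map_map hY hS
  calc μ {ω | Complex.normSq (S ω) ≤ Z (Y ω)}
      = μ.map (fun ω => (Y ω, S ω)) {p : β × ℂ | Complex.normSq p.2 ≤ Z p.1} := by
        rw [Measure.map_apply_of_aemeasurable (hY.prodMk hS) hT]; rfl
    _ = ∫⁻ y, μ.map S {z | Complex.normSq z ≤ Z y} ∂(μ.map Y) := by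
        rw [hmap, Measure.prod_apply hT]; rfl
    _ ≤ ∫⁻ y, ENNReal.ofReal (Z y / τ) ∂(μ.map Y) := lintegral_mono fun y => hball _
    _ = ∫⁻ ω, ENNReal.ofReal (Z (Y ω) / τ) ∂μ :=
        lintegral_map' (hZ.div_const τ).ennreal_ofReal.aemeasurable hY

namespace IsCircularGaussian

variable {Ω : Type*} [MeasurableSpace Ω] {n : Type*} [Fintype n]
  {ξ : Ω → n → ℂ} {W : Matrix n n ℂ} {μ : Measure Ω}

lemma normSq_mulVec_eq (d : n → n → ℂ) (x : n → ℂ) (i : n) :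
    Complex.normSq ((Matrix.of fun i j => star (d i j)).mulVec x i) =
      matInner (outer (d i)) (outer x) := by
  rw [matInner_outer_outer]
  rfl

lemma diag_conj_re (d : n → n → ℂ) (i : n) :
    ((Matrix.of fun i j => star (d i j)) * W *
      (Matrix.of fun i j => star (d i j)).conjTranspose) i i =
      star (d i) ⬝ᵥ W.mulVec (d i) := by
  rw [Matrix.mul_assoc]
  simp [Matrix.mul_apply, dotProduct, Matrix.mulVec]

/-- The expectation of a positive semidefinite quadratic form. -/
lemma lintegral_matInner (h : IsCircularGaussian ξ W μ) {D : Matrix n n ℂ} (hD : D.PosSemidef) :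
    ∫⁻ ω, ENNReal.ofReal (matInner D (outer (ξ ω))) ∂μ = ENNReal.ofReal (matInner D W) := by
  obtain ⟨d, rfl⟩ := hD.exists_eq_sum_outer
  have hη := h.mulVec (Matrix.of fun i j => star (d i j))
  have h1 : ∀ ω, matInner (∑ i, outer (d i)) (outer (ξ ω)) =
      ∑ i, Complex.normSq ((Matrix.of fun i j => star (d i j)).mulVec (ξ ω) i) := fun ω => by
    simp only [matInner_sum_left, normSq_mulVec_eq]
  simp only [h1]
  rw [← ofReal_integral_eq_lintegral_ofReal
    (integrable_finsetSum _ fun i _ => hη.integrable_normSq i)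
    (.of_forall fun ω => Finset.sum_nonneg fun i _ => Complex.normSq_nonneg _),
    integral_finsetSum _ fun i _ => hη.integrable_normSq i, matInner_sum_left]
  congr 1
  refine Finset.sum_congr rfl fun i _ => ?_
  rw [matInner_outer_left, ← diag_conj_re d i, hη.cov_diag i, Complex.ofReal_re]

/-- Exponential tail bound for a positive semidefinite quadratic form. -/
lemma measure_matInner_gt_le (h : IsCircularGaussian ξ W μ) {D : Matrix n n ℂ}
    (hD : D.PosSemidef) {P β : ℝ} (hP : 0 < P) (hβ : 0 ≤ β) (hDW : matInner D W ≤ P) :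
    μ {ω | β * P < matInner D (outer (ξ ω))} ≤ ENNReal.ofReal (2 * Real.exp (-(β / 2))) := by
  -- If the mean is zero the form vanishes almost surely; this case is separate because the exponent
  -- below divides by the mean.
  rcases le_or_gt (matInner D W) 0 with h0 | h0
  · have hl := h.lintegral_matInner hD
    rw [ENNReal.ofReal_of_nonpos h0] at hl
    have hm : AEMeasurable (fun ω => ENNReal.ofReal (matInner D (outer (ξ ω)))) μ :=
      ((continuous_matInner_outer D).measurable.comp_aemeasurable
        h.gaussian.aemeasurable).ennreal_ofReal
    rw [lintegral_eq_zero_iff' hm] at hl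
    refine (le_of_eq ?_).trans zero_le
    refine measure_mono_null ?_ (ae_iff.mp hl)
    intro ω hω
    have : 0 < matInner D (outer (ξ ω)) := lt_of_le_of_lt (by positivity) hω
    simpa using this
  obtain ⟨d, rfl⟩ := hD.exists_eq_sum_outer
  have hη := h.mulVec (Matrix.of fun i j => star (d i j))
  have h1 : ∀ ω, matInner (∑ i, outer (d i)) (outer (ξ ω)) =
      ∑ i, Complex.normSq ((Matrix.of fun i j => star (d i j)).mulVec (ξ ω) i) := fun ω => by
    simp only [matInner_sum_left, normSq_mulVec_eq]
  have hτ : matInner (∑ i, outer (d i)) W = ∑ i, (((Matrix.of fun i j => star (d i j)) * W *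
      (Matrix.of fun i j => star (d i j)).conjTranspose) i i).re := by
    simp only [matInner_sum_left, matInner_outer_left, diag_conj_re]
  have hexp := hη.lintegral_exp_sum_normSq_le (by rw [← hτ]; exact h0)
  rw [← hτ] at hexp
  simp only [← h1] at hexp
  set τ := matInner (∑ i, outer (d i)) W
  have hm : AEMeasurable (fun ω => ENNReal.ofReal
      (Real.exp (matInner (∑ i, outer (d i)) (outer (ξ ω)) / (2 * τ)))) μ :=
    ((((continuous_matInner_outer _).measurable.comp_aemeasurable
      h.gaussian.aemeasurable).div_const _).exp).ennreal_ofReal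
  have hmarkov := mul_meas_ge_le_lintegral₀ hm (ENNReal.ofReal (Real.exp (β / 2)))
  have hsub : {ω | β * P < matInner (∑ i, outer (d i)) (outer (ξ ω))} ⊆
      {ω | ENNReal.ofReal (Real.exp (β / 2)) ≤ ENNReal.ofReal
        (Real.exp (matInner (∑ i, outer (d i)) (outer (ξ ω)) / (2 * τ)))} := by
    intro ω hω
    refine ENNReal.ofReal_le_ofReal (Real.exp_le_exp.mpr ?_)
    rw [le_div_iff₀ (by positivity)]
    have h2 : β * τ ≤ β * P := mul_le_mul_of_nonneg_left hDW hβ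
    have h3 : β * P < matInner (∑ i, outer (d i)) (outer (ξ ω)) := hω
    linarith
  have hfin : ENNReal.ofReal (Real.exp (β / 2)) * μ _ ≤ 2 :=
    (mul_le_mul_right (measure_mono hsub) _).trans (hmarkov.trans hexp)
  rw [mul_comm 2, ENNReal.ofReal_mul (Real.exp_nonneg _), Real.exp_neg,
    ENNReal.ofReal_inv_of_pos (Real.exp_pos _), ENNReal.ofReal_ofNat, mul_comm _ (2 : ENNReal),
    ← div_eq_mul_inv]
  rw [ENNReal.le_div_iff_mul_le (Or.inl (by simpa using Real.exp_pos _)) (Or.inl (by simp)),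
    mul_comm]
  exact hfin

/-- A rank-one form `|aᴴ ξ|²` is, up to a factor `κ` of its mean, rarely dominated by a
positive semidefinite form and a constant. -/
lemma measure_rankOne_lt_le (h : IsCircularGaussian ξ W μ) (hW : W.PosSemidef) (a : n → ℂ)
    {C : Matrix n n ℂ} (hC : C.PosSemidef) {κ β : ℝ} (hκ : 2 < κ) (hβ : 2 ≤ β)
    (ha : 0 < matInner (outer a) W) :
    μ {ω | κ * (matInner C W + 1) * matInner (outer a) (outer (ξ ω)) <
        matInner (outer a) W * (matInner C (outer (ξ ω)) + β)} ≤
      ENNReal.ofReal (β / (κ - 2)) := by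
  classical
  have hP := h.gaussian.isProbabilityMeasure
  set q := matInner C W with hq
  have hq0 : 0 ≤ q := matInner_nonneg hC hW
  set τ := matInner (outer a) W with hτ
  have hτc : star a ⬝ᵥ W.mulVec a = (τ : ℂ) := by
    have h2 := (Complex.le_def.mp (hW.dotProduct_mulVec_nonneg a)).2
    rw [hτ, matInner_outer_left]
    exact Complex.ext rfl h2.symm
  have hτ0 : (τ : ℂ) ≠ 0 := by exact_mod_cast ha.ne'
  -- The regression vector of ξ on s = aᴴξ: the residual ξ - s b = `B₂` ξ is uncorrelated with s,
  -- hence independent of it.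
  set b : n → ℂ := (τ : ℂ)⁻¹ • W.mulVec a with hb
  have hWa : W.mulVec a = (τ : ℂ) • b := by rw [hb, smul_smul, mul_inv_cancel₀ hτ0, one_smul]
  have haW : Matrix.vecMul (star a) W = (τ : ℂ) • star b := by
    have : star (W.mulVec a) = Matrix.vecMul (star a) W := by
      rw [Matrix.star_mulVec, hW.isHermitian.eq]
    rw [← this, hWa]
    ext i
    simp
  have hab : star a ⬝ᵥ b = 1 := by
    rw [hb, dotProduct_smul, hτc, smul_eq_mul, inv_mul_cancel₀ hτ0]
  have hba : star b ⬝ᵥ a = 1 := by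
    have : star b ⬝ᵥ a = conj (star a ⬝ᵥ b) := by simp [dotProduct, map_sum, mul_comm]
    rw [this, hab, map_one]
  set B₁ : Matrix Unit n ℂ := Matrix.replicateRow Unit (star a) with hB₁
  set B₂ : Matrix n n ℂ := 1 - Matrix.vecMulVec b (star a) with hB₂
  have hB₂H : B₂.conjTranspose = 1 - Matrix.vecMulVec a (star b) := by
    rw [hB₂, Matrix.conjTranspose_sub, Matrix.conjTranspose_one, Matrix.conjTranspose_vecMulVec,
      star_star]
  have hB₂W : B₂ * W = W - (τ : ℂ) • outer b := by
    rw [hB₂, sub_mul, one_mul, Matrix.vecMulVec_mul, haW, Matrix.vecMulVec_smul]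
    rfl
  have hcov₂ : B₂ * W * B₂.conjTranspose = W - (τ : ℂ) • outer b := by
    rw [hB₂W, hB₂H, mul_sub, mul_one, sub_mul, Matrix.mul_vecMulVec, hWa, smul_mul_assoc,
      Matrix.mul_vecMulVec, outer_mulVec, hba, one_smul, Matrix.smul_vecMulVec]
    simp [outer]
  have hcov₁₂ : B₁ * W * B₂.conjTranspose = 0 := by
    have : (B₂ * W * B₁.conjTranspose) = 0 := by
      rw [hB₂W]
      ext i j
      have e1 : (W * B₁.conjTranspose) i j = W.mulVec a i := by
        simp [Matrix.mul_apply, Matrix.mulVec, dotProduct, hB₁]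
      have e2 : (outer b * B₁.conjTranspose) i j = (outer b).mulVec a i := by
        simp [Matrix.mul_apply, Matrix.mulVec, dotProduct, hB₁]
      rw [Matrix.sub_mul, Matrix.smul_mul, Matrix.sub_apply, Matrix.smul_apply, e1, e2, outer_mulVec, hba,
        hWa]
      simp
    have := congrArg Matrix.conjTranspose this
    simpa [Matrix.conjTranspose_mul, hW.isHermitian.eq, Matrix.mul_assoc] using this
  have hη₁ := h.mulVec B₁
  have hη₂ := h.mulVec B₂
  have hτ₁ : ((B₁ * W * B₁.conjTranspose) () ()).re = τ := by
    rw [Matrix.mul_assoc]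
    have : (B₁ * (W * B₁.conjTranspose)) () () = star a ⬝ᵥ W.mulVec a := by
      simp [Matrix.mul_apply, Matrix.mulVec, dotProduct, hB₁]
    rw [this, hτc, Complex.ofReal_re]
  have hind : IndepFun (fun ω => B₁.mulVec (ξ ω) ()) (fun ω => B₂.mulVec (ξ ω)) μ :=
    (h.indepFun_mulVec B₁ B₂ hcov₁₂).comp (measurable_pi_apply ()) measurable_id
  have hball := hη₁.map_coord_normSq_le () (by rw [hτ₁]; exact ha)
  rw [hτ₁] at hball
  have hκq : 0 < (κ - 2) * (q + 1) := mul_pos (by linarith) (by linarith)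
  have hdec : ∀ x : n → ℂ, x = (star a ⬝ᵥ x) • b + B₂.mulVec x := by
    intro x
    rw [hB₂, Matrix.sub_mulVec, Matrix.one_mulVec]
    have : (Matrix.vecMulVec b (star a)).mulVec x = (star a ⬝ᵥ x) • b := by
      ext i
      simp only [Matrix.mulVec, dotProduct, Matrix.vecMulVec_apply, Pi.smul_apply, smul_eq_mul,
        Finset.sum_mul]
      exact Finset.sum_congr rfl fun j _ => by ring
    rw [this]
    abel
  -- The covariance splits as W = τ b bᴴ + (residual covariance), so both parts of the mean
  -- interference are at most q.
  have hCb : τ * matInner C (outer b) = q - matInner C (B₂ * W * B₂.conjTranspose) := by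
    rw [hcov₂]
    simp [matInner, mul_sub, hq]
  have hC2 : 0 ≤ matInner C (B₂ * W * B₂.conjTranspose) :=
    matInner_nonneg hC (hW.mul_mul_conjTranspose_same B₂)
  have hCb0 : 0 ≤ matInner C (outer b) := matInner_nonneg hC (posSemidef_outer b)
  -- The interference is at most twice that of s b plus twice that of the residual. The first
  -- contributes at most 2q|s|² after multiplication by τ; moving it to the left leaves the
  -- coefficient κ(q+1) - 2q ≥ (κ-2)(q+1) of |s|².
  let Z : (n → ℂ) → ℝ := fun y => τ * (2 * matInner C (outer y) + β) / ((κ - 2) * (q + 1))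
  have hZ : Measurable Z := by
    have := (continuous_matInner_outer C).measurable
    fun_prop
  have hsub : {ω | κ * (q + 1) * matInner (outer a) (outer (ξ ω)) <
        τ * (matInner C (outer (ξ ω)) + β)} ⊆
      {ω | Complex.normSq (B₁.mulVec (ξ ω) ()) ≤ Z (B₂.mulVec (ξ ω))} := by
    intro ω hω
    have hω : κ * (q + 1) * matInner (outer a) (outer (ξ ω)) <
        τ * (matInner C (outer (ξ ω)) + β) := hω
    have hsplit : matInner C (outer (ξ ω)) ≤ 2 * (Complex.normSq (star a ⬝ᵥ ξ ω) *
        matInner C (outer b)) + 2 * matInner C (outer (B₂.mulVec (ξ ω))) := by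
      conv_lhs => rw [hdec (ξ ω)]
      refine (matInner_outer_add_le hC _ _).trans (le_of_eq ?_)
      rw [matInner_outer_smul]
    rw [matInner_outer_outer] at hω
    change Complex.normSq (star a ⬝ᵥ ξ ω) ≤ _
    set s := Complex.normSq (star a ⬝ᵥ ξ ω)
    have hs0 : 0 ≤ s := Complex.normSq_nonneg _
    simp only [Z]
    rw [le_div_iff₀ hκq]
    have h1 : s * (τ * matInner C (outer b)) ≤ s * q :=
      mul_le_mul_of_nonneg_left (by linarith) hs0
    have h2 := mul_le_mul_of_nonneg_left hsplit ha.le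
    nlinarith
  refine (measure_mono hsub).trans ((measure_normSq_le_of_indepFun
    (hη₁.hasGaussianLaw_coord ()).aemeasurable hη₂.gaussian.aemeasurable hind hball hZ).trans ?_)
  have hZτ : ∀ y, Z y / τ = 2 / ((κ - 2) * (q + 1)) * matInner C (outer y)
      + β / ((κ - 2) * (q + 1)) := by
    intro y
    simp only [Z]
    field_simp
  simp only [hZτ]
  have hk0 : 0 ≤ 2 / ((κ - 2) * (q + 1)) := by positivity
  have hk1 : 0 ≤ β / ((κ - 2) * (q + 1)) := by positivity
  have hm : AEMeasurable (fun ω => ENNReal.ofReal (matInner C (outer (B₂.mulVec (ξ ω))))) μ :=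
    ((continuous_matInner_outer C).measurable.comp_aemeasurable
      hη₂.gaussian.aemeasurable).ennreal_ofReal
  calc ∫⁻ ω, ENNReal.ofReal (2 / ((κ - 2) * (q + 1)) * matInner C (outer (B₂.mulVec (ξ ω)))
        + β / ((κ - 2) * (q + 1))) ∂μ
      = ∫⁻ ω, (ENNReal.ofReal (2 / ((κ - 2) * (q + 1))) *
          ENNReal.ofReal (matInner C (outer (B₂.mulVec (ξ ω))))
        + ENNReal.ofReal (β / ((κ - 2) * (q + 1)))) ∂μ := by
        refine lintegral_congr fun ω => ?_
        rw [ENNReal.ofReal_add (mul_nonneg hk0 (matInner_nonneg hC (posSemidef_outer _))) hk1,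
          ENNReal.ofReal_mul hk0]
    _ = ENNReal.ofReal (2 / ((κ - 2) * (q + 1)) * matInner C (B₂ * W * B₂.conjTranspose)
        + β / ((κ - 2) * (q + 1))) := by
        rw [lintegral_add_right _ measurable_const, lintegral_const_mul'' _ hm,
          hη₂.lintegral_matInner hC, lintegral_const, measure_univ, mul_one,
          ENNReal.ofReal_add (mul_nonneg hk0 hC2) hk1, ENNReal.ofReal_mul hk0]
    _ ≤ ENNReal.ofReal (β / (κ - 2)) := by
        refine ENNReal.ofReal_le_ofReal ?_
        have hle : matInner C (B₂ * W * B₂.conjTranspose) ≤ q := by nlinarith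
        rw [div_mul_eq_mul_div, ← add_div, div_le_div_iff₀ hκq (by linarith)]
        -- Here β ≥ 2 absorbs the factor 2 of the residual interference, and the dependence on q
        -- cancels.
        have : 2 * matInner C (B₂ * W * B₂.conjTranspose) + β ≤ β * (q + 1) := by nlinarith
        calc _ ≤ β * (q + 1) * (κ - 2) := mul_le_mul_of_nonneg_right this (by linarith)
          _ = _ := by ring

end IsCircularGaussian

/-! ### Analysis of Gaussian randomization for the relay network. -/

namespace RelayNetwork

variable {G : ℕ} {m : Fin G → ℕ} {L : ℕ} (S : RelayNetwork G m L)

lemma posDef_noiseCov : S.noiseCov.PosDef := by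
  refine Matrix.PosDef.diagonal fun l => ?_
  have : (0 : ℝ) < S.σR l ^ 2 := pow_pos (S.σR_pos l) 2
  exact_mod_cast this

lemma posSemidef_ofReal_smul {n : Type*} {A : Matrix n n ℂ} (hA : A.PosSemidef) {c : ℝ}
    (hc : 0 ≤ c) : ((c : ℂ) • A).PosSemidef :=
  hA.smul (by exact_mod_cast hc)

lemma posDef_rxCov : S.rxCov.PosDef :=
  Matrix.PosDef.posSemidef_add (Matrix.posSemidef_sum _ fun j _ =>
    posSemidef_ofReal_smul (posSemidef_outer _) (S.P_nonneg j)) S.posDef_noiseCov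

lemma posSemidef_A (u : Σ k, Fin (m k)) : (S.A u).PosSemidef :=
  posSemidef_ofReal_smul (posSemidef_outer _) (div_nonneg (S.P_nonneg _) (sq_nonneg _))

lemma posSemidef_C (u : Σ k, Fin (m k)) : (S.C u).PosSemidef :=
  (Matrix.posSemidef_sum _ fun j _ =>
    posSemidef_ofReal_smul (posSemidef_outer _) (div_nonneg (S.P_nonneg _) (sq_nonneg _))).add
  (posSemidef_ofReal_smul (S.posDef_noiseCov.posSemidef.kronecker (posSemidef_outer _))
    (by positivity))

lemma posSemidef_D (l : Option (Fin L)) : (S.D l).PosSemidef := by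
  cases l with
  | none => exact S.posDef_rxCov.posSemidef.kronecker Matrix.PosSemidef.one
  | some l =>
    refine S.posDef_rxCov.posSemidef.kronecker ?_
    rw [← Matrix.diagonal_single]
    exact Matrix.PosSemidef.diagonal fun i => by
      by_cases h : i = l
      · subst h; simp
      · simp [h]

lemma matInner_D_none_pos {x : VecIdx L → ℂ} (hx : x ≠ 0) :
    0 < matInner (S.D none) (outer x) := by
  have hD : (S.D none).PosDef := S.posDef_rxCov.kronecker Matrix.PosDef.one
  rw [matInner_outer_right _ _ hD.isHermitian]
  exact (Complex.lt_def.mp (hD.dotProduct_mulVec_pos hx)).1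

lemma ratio_nonneg (u : Σ k, Fin (m k)) {W : Matrix (VecIdx L) (VecIdx L) ℂ} (hW : W.PosSemidef) :
    0 ≤ matInner (S.A u) W / (matInner (S.C u) W + 1) :=
  div_nonneg (matInner_nonneg (S.posSemidef_A u) hW)
    (add_nonneg (matInner_nonneg (S.posSemidef_C u) hW) zero_le_one)

lemma gam_nonneg {W : Matrix (VecIdx L) (VecIdx L) ℂ} (hW : W.PosSemidef) : 0 ≤ S.gam W :=
  Real.iInf_nonneg fun u => S.ratio_nonneg u hW

lemma gam_le (u : Σ k, Fin (m k)) (W : Matrix (VecIdx L) (VecIdx L) ℂ) :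
    S.gam W ≤ matInner (S.A u) W / (matInner (S.C u) W + 1) :=
  ciInf_le (Set.finite_range _).bddBelow u

/-- If all powers of `x` exceed their thresholds by a factor of at most `β`, then rescaling
shrinks the squared norm by at most `β`. -/
lemma exists_rescale_eq_smul {x : VecIdx L → ℂ} (hx : x ≠ 0) {β : ℝ} (hβ : 0 < β)
    (h : ∀ l, matInner (S.D l) (outer x) ≤ β * S.Pbar l) :
    ∃ t : ℝ, 1 / β ≤ t ^ 2 ∧ S.rescale x = (t : ℂ) • x := by
  refine ⟨_, ?_, rfl⟩
  set F : Option (Fin L) → ENNReal := fun l =>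
    (ENNReal.ofReal (S.Pbar l) / ENNReal.ofReal (matInner (S.D l) (outer x))) ^ (1 / 2 : ℝ)
  have hfin : (⨅ l, F l) ≠ ⊤ := by
    refine ne_top_of_le_ne_top ?_ (iInf_le F none)
    refine ENNReal.rpow_ne_top_of_nonneg (by norm_num) (ENNReal.div_ne_top ENNReal.ofReal_ne_top ?_)
    simpa using S.matInner_D_none_pos hx
  have hle : ENNReal.ofReal (Real.sqrt (1 / β)) ≤ ⨅ l, F l := by
    refine le_iInf fun l => ?_
    rw [Real.sqrt_eq_rpow, ← ENNReal.ofReal_rpow_of_nonneg (by positivity) (by norm_num)]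
    refine ENNReal.rpow_le_rpow ?_ (by norm_num)
    rw [ENNReal.le_div_iff_mul_le (Or.inr (by simpa using S.Pbar_pos l)) (Or.inl ENNReal.ofReal_ne_top),
      ← ENNReal.ofReal_mul (by positivity)]
    refine ENNReal.ofReal_le_ofReal ?_
    rw [one_div, inv_mul_le_iff₀ hβ]
    exact h l
  have := ENNReal.toReal_mono hfin hle
  rw [ENNReal.toReal_ofReal (Real.sqrt_nonneg _)] at this
  exact Real.sqrt_le_iff.mp this |>.2

/-- The draws for which randomization is guaranteed to work. -/
def goodDraws (W : Matrix (VecIdx L) (VecIdx L) ℂ) (β κ : ℝ) : Set (VecIdx L → ℂ) :=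
  {x | (∀ l, matInner (S.D l) (outer x) ≤ β * S.Pbar l) ∧
    ∀ u, matInner (S.A u) W * (matInner (S.C u) (outer x) + β) ≤
      κ * (matInner (S.C u) W + 1) * matInner (S.A u) (outer x)}

lemma measurableSet_goodDraws (W : Matrix (VecIdx L) (VecIdx L) ℂ) (β κ : ℝ) :
    MeasurableSet (S.goodDraws W β κ) := by
  refine IsClosed.measurableSet ?_
  have h1 := fun M => continuous_matInner_outer (n := VecIdx L) M
  refine IsClosed.and ?_ ?_
  · simp only [Set.ofPred_forall]
    exact isClosed_iInter fun l => isClosed_le (h1 _) continuous_const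
  · simp only [Set.ofPred_forall]
    exact isClosed_iInter fun u => isClosed_le
      (continuous_const.mul ((h1 _).add continuous_const)) (continuous_const.mul (h1 _))

/-- Scaling by t² ≥ 1/β turns the constant β in the good event into at least the unit noise. The
comparison holds for each user, so it passes to the minimum. -/
lemma gam_le_of_mem_goodDraws [Nonempty (Σ k, Fin (m k))] {W : Matrix (VecIdx L) (VecIdx L) ℂ}
    (hW : W.PosSemidef) {β κ : ℝ} (hβ : 0 < β) (hκ : 0 < κ) {x : VecIdx L → ℂ}
    (hx : x ∈ S.goodDraws W β κ) : S.gam W ≤ κ * S.gam (outer (S.rescale x)) := by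
  obtain ⟨hD, hA⟩ := hx
  -- The zero vector is good only if every signal term of W vanishes, and then γ(W) ≤ 0.
  by_cases hx0 : x = 0
  · obtain ⟨u⟩ := ‹Nonempty (Σ k, Fin (m k))›
    have h0 : ∀ M : Matrix (VecIdx L) (VecIdx L) ℂ, matInner M (outer x) = 0 := by
      intro M
      have : outer x = 0 := by ext; simp [hx0, outer, Matrix.vecMulVec_apply]
      simp [this, matInner]
    have h1 := hA u
    rw [h0, h0, zero_add, mul_zero] at h1
    have h2 : matInner (S.A u) W = 0 :=
      le_antisymm (nonpos_of_mul_nonpos_left h1 hβ) (matInner_nonneg (S.posSemidef_A u) hW)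
    have h3 := S.gam_le u W
    rw [h2, zero_div] at h3
    exact h3.trans (mul_nonneg hκ.le (S.gam_nonneg (posSemidef_outer _)))
  obtain ⟨t, ht, hr⟩ := S.exists_rescale_eq_smul hx0 hβ hD
  rw [← div_le_iff₀' hκ]
  refine le_ciInf fun u => ?_
  rw [hr, matInner_outer_smul, matInner_outer_smul, Complex.normSq_ofReal, ← pow_two]
  refine (div_le_div_of_nonneg_right (S.gam_le u W) hκ.le).trans ?_
  have hA0 := matInner_nonneg (S.posSemidef_A u) hW
  have ha0 := matInner_nonneg (S.posSemidef_A u) (posSemidef_outer x)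
  have hC0 := matInner_nonneg (S.posSemidef_C u) hW
  have hc0 := matInner_nonneg (S.posSemidef_C u) (posSemidef_outer x)
  have hu := hA u
  set a := matInner (S.A u) (outer x)
  set c := matInner (S.C u) (outer x)
  set A := matInner (S.A u) W
  set C := matInner (S.C u) W
  rw [div_div, div_le_div_iff₀ (by positivity) (by positivity)]
  have hβt : 1 ≤ t ^ 2 * β := by rwa [div_le_iff₀ hβ] at ht
  have : A * (t ^ 2 * c + 1) ≤ t ^ 2 * (A * (c + β)) := by
    have := mul_le_mul_of_nonneg_left hβt hA0
    nlinarith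
  refine this.trans ?_
  have := mul_le_mul_of_nonneg_left hu (sq_nonneg t)
  linarith

lemma measure_compl_goodDraws_le {Ω : Type*} [MeasurableSpace Ω] {μ : Measure Ω}
    {ξ : Ω → VecIdx L → ℂ} {W : Matrix (VecIdx L) (VecIdx L) ℂ} (hξ : IsCircularGaussian ξ W μ)
    (hW : W ∈ S.sdrFeasible) {β κ : ℝ} (hβ : 2 ≤ β) (hκ : 2 < κ) :
    μ (ξ ⁻¹' (S.goodDraws W β κ)ᶜ) ≤
      ENNReal.ofReal ((L + 1) * (2 * Real.exp (-(β / 2))) + (∑ k, m k : ℕ) * (β / (κ - 2))) := by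
  have hsub : ξ ⁻¹' (S.goodDraws W β κ)ᶜ ⊆
      (⋃ l, {ω | β * S.Pbar l < matInner (S.D l) (outer (ξ ω))}) ∪
      ⋃ u, {ω | κ * (matInner (S.C u) W + 1) * matInner (S.A u) (outer (ξ ω)) <
        matInner (S.A u) W * (matInner (S.C u) (outer (ξ ω)) + β)} := by
    intro ω hω
    by_contra hcon
    simp only [Set.mem_union, Set.mem_iUnion, not_or, not_exists] at hcon
    exact hω ⟨fun l => not_lt.mp (hcon.1 l), fun u => not_lt.mp (hcon.2 u)⟩
  have hpow : ∀ l, μ {ω | β * S.Pbar l < matInner (S.D l) (outer (ξ ω))} ≤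
      ENNReal.ofReal (2 * Real.exp (-(β / 2))) := fun l =>
    hξ.measure_matInner_gt_le (S.posSemidef_D l) (S.Pbar_pos l) (by linarith) (hW.2 l)
  have huser : ∀ u, μ {ω | κ * (matInner (S.C u) W + 1) * matInner (S.A u) (outer (ξ ω)) <
        matInner (S.A u) W * (matInner (S.C u) (outer (ξ ω)) + β)} ≤
      ENNReal.ofReal (β / (κ - 2)) := by
    intro u
    have hp : 0 ≤ S.P u.1 / S.σU u ^ 2 := div_nonneg (S.P_nonneg _) (sq_nonneg _)
    have hA : ∀ M, matInner (S.A u) M = S.P u.1 / S.σU u ^ 2 * matInner (outer (S.chan u.1 u)) M :=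
      fun M => matInner_smul_left _ _ _
    have hC0 := matInner_nonneg (S.posSemidef_C u) hW.1
    -- A user without signal under W cannot fail, as its inequality has left side zero. Otherwise
    -- the common power factor is dropped and the rank-one estimate applies.
    rcases (matInner_nonneg (posSemidef_outer (S.chan u.1 u)) hW.1).eq_or_lt with h0 | h0
    · refine (le_of_eq ?_).trans zero_le
      convert measure_empty (μ := μ)
      refine Set.eq_empty_of_forall_notMem fun ω hω => ?_
      rw [Set.mem_ofPred_eq] at hω
      rw [hA W, ← h0, mul_zero, zero_mul] at hω
      exact absurd hω (not_lt.mpr (mul_nonneg (mul_nonneg (by linarith) (by linarith))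
        (matInner_nonneg (S.posSemidef_A u) (posSemidef_outer _))))
    · refine (measure_mono fun ω hω => ?_).trans
        (hξ.measure_rankOne_lt_le hW.1 (S.chan u.1 u) (S.posSemidef_C u) hκ hβ h0)
      rw [Set.mem_ofPred_eq] at hω
      rw [hA, hA] at hω
      refine lt_of_mul_lt_mul_left (a := S.P u.1 / S.σU u ^ 2) ?_ hp
      linarith
  refine (measure_mono hsub).trans ((measure_union_le _ _).trans ?_)
  rw [ENNReal.ofReal_add (by positivity)
    (mul_nonneg (by positivity) (div_nonneg (by linarith) (by linarith)))]
  refine add_le_add ?_ ?_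
  · refine (measure_iUnion_fintype_le _ _).trans ((Finset.sum_le_sum fun l _ => hpow l).trans ?_)
    rw [Finset.sum_const, Finset.card_univ, Fintype.card_option, Fintype.card_fin,
      ← ENNReal.ofReal_nsmul, nsmul_eq_mul]
    push_cast
    rfl
  · refine (measure_iUnion_fintype_le _ _).trans ((Finset.sum_le_sum fun u _ => huser u).trans ?_)
    rw [Finset.sum_const, Finset.card_univ, Fintype.card_sigma,
      ← ENNReal.ofReal_nsmul, nsmul_eq_mul]
    simp

lemma two_le_log_three_mul (hL : 2 ≤ L) : 2 ≤ Real.log (3 * ((L : ℝ) + 1)) := by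
  have h2 : (2 : ℝ) ≤ L := by exact_mod_cast hL
  rw [Real.le_log_iff_exp_le (by positivity)]
  have h1 := Real.exp_one_lt_d9
  have : Real.exp 2 = Real.exp 1 * Real.exp 1 := by rw [← Real.exp_add]; norm_num
  rw [this]
  nlinarith [Real.exp_pos 1]

/-- For κ ≥ 1, 1 + κγ ≤ κ(1 + γ), so a factor κ in SINR costs at most log κ in rate. -/
lemma rate_sub_rate_le {W W' : Matrix (VecIdx L) (VecIdx L) ℂ} (hW' : W'.PosSemidef)
    (hW : W.PosSemidef) {κ : ℝ} (hκ : 1 ≤ κ) (h : S.gam W ≤ κ * S.gam W') :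
    S.rate W - S.rate W' ≤ Real.log κ := by
  have h0 := S.gam_nonneg hW
  have h1 := S.gam_nonneg hW'
  rw [rate, rate, sub_le_iff_le_add, ← Real.log_mul (by positivity) (by positivity)]
  exact Real.log_le_log (by positivity) (by nlinarith)

/-- Gaussian randomization with `N` independent draws. -/
theorem randomization_gap (hL : 2 ≤ L) (hM : 1 ≤ ∑ k, m k) {W : Matrix (VecIdx L) (VecIdx L) ℂ}
    (hW : W ∈ S.sdrFeasible) {N : ℕ} {Ω : Type*} [MeasurableSpace Ω] {μ : Measure Ω}
    [IsProbabilityMeasure μ] {ξ : Fin N → Ω → VecIdx L → ℂ}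
    (hξ : ∀ n, IsCircularGaussian (ξ n) W μ) (hind : iIndepFun ξ μ) {w : Ω → VecIdx L → ℂ}
    (hw : ∀ ω, S.IsOutput W (fun n => ξ n ω) (w ω)) :
    ENNReal.ofReal (1 - (5 / 6 : ℝ) ^ N) ≤
      μ {ω | S.rate W - S.rate (outer (w ω)) ≤
        Real.log ((∑ k, m k : ℕ) : ℝ) + Real.log (Real.log (3 * ((L : ℝ) + 1)) + 1 / 6)
          + Real.log 48} := by
  have hl := two_le_log_three_mul hL
  set ℓ := Real.log (3 * ((L : ℝ) + 1)) with hℓ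
  set M : ℕ := ∑ k, m k with hMdef
  have hM1 : (1 : ℝ) ≤ M := by exact_mod_cast hM
  have hκlog : Real.log M + Real.log (ℓ + 1 / 6) + Real.log 48 =
      Real.log (48 * M * (ℓ + 1 / 6)) := by
    rw [Real.log_mul (by positivity) (by positivity), Real.log_mul (by positivity) (by positivity)]
    ring
  set κ : ℝ := 48 * M * (ℓ + 1 / 6) with hκ
  have hκ96 : 96 ≤ κ := by rw [hκ]; nlinarith
  rw [hκlog]
  by_cases hrank : W.rank ≤ 1
  · have : {ω | S.rate W - S.rate (outer (w ω)) ≤ Real.log κ} = Set.univ := by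
      refine Set.eq_univ_of_forall fun ω => ?_
      have h1 := hw ω
      rw [IsOutput, if_pos hrank] at h1
      rw [Set.mem_ofPred_eq, ← h1, sub_self]
      exact Real.log_nonneg (by linarith)
    rw [this, measure_univ]
    exact ENNReal.ofReal_le_one.mpr (by simp; positivity)
  have : Nonempty (Σ k, Fin (m k)) := by
    rw [← Fintype.card_pos_iff, Fintype.card_sigma]
    simp only [Fintype.card_fin]
    exact hM
  -- With β = 2ℓ the tail factor exp(-β/2) equals 1/(3(L+1)), so the L + 1 power constraints fail
  -- with total probability at most 2/3.
  set E := S.goodDraws W (2 * ℓ) κ with hE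
  have hEm : MeasurableSet E := S.measurableSet_goodDraws W _ _
  have hbad : ∀ n, μ (ξ n ⁻¹' Eᶜ) ≤ ENNReal.ofReal (5 / 6) := by
    intro n
    refine (S.measure_compl_goodDraws_le (hξ n) hW (by linarith) (by linarith)).trans
      (ENNReal.ofReal_le_ofReal ?_)
    have h1 : Real.exp (-(2 * ℓ / 2)) = 1 / (3 * ((L : ℝ) + 1)) := by
      rw [mul_div_cancel_left₀ _ (by norm_num), Real.exp_neg, hℓ, Real.exp_log (by positivity),
        one_div]
    have h2 : ((L : ℝ) + 1) * (2 * Real.exp (-(2 * ℓ / 2))) = 2 / 3 := by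
      rw [h1]; field_simp
    have h3 : (M : ℝ) * (2 * ℓ / (κ - 2)) ≤ 1 / 6 := by
      rw [← mul_div_assoc, div_le_div_iff₀ (by linarith) (by norm_num), hκ]
      nlinarith
    rw [h2]
    linarith
  have hcompl : {ω | S.rate W - S.rate (outer (w ω)) ≤ Real.log κ}ᶜ ⊆ ⋂ n, ξ n ⁻¹' Eᶜ := by
    intro ω hω
    refine Set.mem_iInter.mpr fun n hn => hω ?_
    have h1 := hw ω
    rw [IsOutput, if_neg hrank] at h1
    obtain ⟨n', hmax, hwn⟩ := h1
    have h2 := S.gam_le_of_mem_goodDraws hW.1 (by linarith) (by linarith) hn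
    refine S.rate_sub_rate_le (posSemidef_outer _) hW.1 (by linarith) (h2.trans ?_)
    rw [hwn]
    exact mul_le_mul_of_nonneg_left (hmax n) (by linarith)
  have hprod : μ (⋂ n, ξ n ⁻¹' Eᶜ) ≤ ENNReal.ofReal ((5 / 6) ^ N) := by
    rw [hind.meas_iInter fun n => ⟨Eᶜ, hEm.compl, rfl⟩]
    refine (Finset.prod_le_prod' fun n _ => hbad n).trans ?_
    rw [Finset.prod_const, Finset.card_univ, Fintype.card_fin, ENNReal.ofReal_pow (by norm_num)]
  rw [ENNReal.ofReal_sub _ (by positivity), ENNReal.ofReal_one, tsub_le_iff_right]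
  -- Only subadditivity is used for the complement: `w` is an arbitrary selection of outputs, so the
  -- event need not be measurable.
  calc (1 : ENNReal) = μ Set.univ := measure_univ.symm
    _ ≤ μ {ω | S.rate W - S.rate (outer (w ω)) ≤ Real.log κ} +
        μ {ω | S.rate W - S.rate (outer (w ω)) ≤ Real.log κ}ᶜ := by
        rw [← Set.union_compl_self]; exact measure_union_le _ _
    _ ≤ _ := add_le_add le_rfl ((measure_mono hcompl).trans hprod)

end RelayNetwork

/-! ### Matrix Cauchy–Schwarz inequalities and Kronecker products for the single-user optimum. -/

section Quadratic

variable {n : Type*} [Fintype n]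

lemma Matrix.IsHermitian.posSemidef_of_matInner_nonneg {M : Matrix n n ℂ} (hM : M.IsHermitian)
    (h : ∀ x, 0 ≤ matInner M (outer x)) : M.PosSemidef := by
  refine Matrix.PosSemidef.of_dotProduct_mulVec_nonneg hM fun x => ?_
  refine Complex.le_def.mpr ⟨?_, ?_⟩
  · simpa [matInner_outer_right _ _ hM] using h x
  · simpa using (hM.im_star_dotProduct_mulVec_self x).symm

lemma isHermitian_outer (w : n → ℂ) : (outer w).IsHermitian := (posSemidef_outer w).isHermitian

/-- If `K z = s φ` with `zᴴ K z = 1`, then `s² φ φᴴ ≤ K`. -/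
lemma posSemidef_sub_outer_of_mulVec_eq {K : Matrix n n ℂ} (hK : K.PosSemidef) {z φ : n → ℂ} {s : ℝ}
    (hz : K.mulVec z = (s : ℂ) • φ) (hzz : star z ⬝ᵥ K.mulVec z = 1) :
    (K - ((s ^ 2 : ℝ) : ℂ) • outer φ).PosSemidef := by
  have hH : (K - ((s ^ 2 : ℝ) : ℂ) • outer φ).IsHermitian :=
    hK.isHermitian.sub ((isHermitian_outer φ).smul (by simp [IsSelfAdjoint]))
  refine hH.posSemidef_of_matInner_nonneg fun x => ?_
  rw [matInner_sub_left, matInner_smul_left, matInner_outer_outer]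
  set c : ℂ := star φ ⬝ᵥ x with hc
  have hzK : star z ⬝ᵥ K.mulVec x = s * c := by
    rw [Matrix.dotProduct_mulVec, show Matrix.vecMul (star z) K = star (K.mulVec z) by
      rw [Matrix.star_mulVec, hK.isHermitian.eq], hz]
    simp [hc]
  have hxK : star x ⬝ᵥ K.mulVec z = s * conj c := by
    rw [hz, dotProduct_smul, hc]
    simp [dotProduct, map_sum, mul_comm]
  -- Since zᴴKx = s c, this subtracts from x its K-orthogonal projection onto z; expanding the form
  -- leaves xᴴKx - s²|c|².
  have h0 := matInner_nonneg hK (posSemidef_outer (x - ((s : ℂ) * c) • z))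
  rw [matInner_outer_right _ _ hK.isHermitian, Matrix.mulVec_sub, Matrix.mulVec_smul, star_sub,
    sub_dotProduct, dotProduct_sub, dotProduct_sub, star_smul, smul_dotProduct, smul_dotProduct,
    dotProduct_smul, dotProduct_smul, hzz, hzK, hxK] at h0
  rw [matInner_outer_right _ _ hK.isHermitian]
  have h1 : star ((s : ℂ) * c) • ((s : ℂ) * c) = ((s ^ 2 * Complex.normSq c : ℝ) : ℂ) := by
    rw [smul_eq_mul, star_mul', RCLike.star_def, Complex.conj_ofReal]
    push_cast
    rw [Complex.normSq_eq_conj_mul_self]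
    ring
  have h2 : ((s : ℂ) * c) • ((s : ℂ) * conj c) = ((s ^ 2 * Complex.normSq c : ℝ) : ℂ) := by
    push_cast
    rw [Complex.normSq_eq_conj_mul_self, smul_eq_mul]
    ring
  rw [h2, smul_eq_mul (b := (1 : ℂ)), mul_one, h1, sub_self, sub_zero, Complex.sub_re,
    Complex.ofReal_re] at h0
  exact h0

/-- A weighted Cauchy–Schwarz inequality `g gᴴ ≤ (∑ₗ |gₗ| pₗ) Diag r` with `|gₗ| = rₗ pₗ`. -/
lemma posSemidef_diagonal_sub_outer [DecidableEq n] {g : n → ℂ} {p r : n → ℝ} (hr : ∀ l, 0 ≤ r l)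
    (hg : ∀ l, ‖g l‖ = r l * p l) :
    (Matrix.diagonal (fun l => (((∑ i, ‖g i‖ * p i) * r l : ℝ) : ℂ)) - outer g).PosSemidef := by
  have hD : (Matrix.diagonal (fun l => (((∑ i, ‖g i‖ * p i) * r l : ℝ) : ℂ))).IsHermitian :=
    Matrix.isHermitian_diagonal_iff.mpr fun l => by simp [IsSelfAdjoint]
  refine (hD.sub (isHermitian_outer g)).posSemidef_of_matInner_nonneg fun x => ?_
  rw [matInner_sub_left, matInner_outer_outer, matInner_outer_right _ _ hD, sub_nonneg]
  have h1 : (star x ⬝ᵥ (Matrix.diagonal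
      (fun l => (((∑ i, ‖g i‖ * p i) * r l : ℝ) : ℂ))).mulVec x).re =
      (∑ i, r i * p i ^ 2) * ∑ l, r l * ‖x l‖ ^ 2 := by
    rw [Finset.mul_sum, dotProduct, Complex.re_sum]
    refine Finset.sum_congr rfl fun l _ => ?_
    have h2 : ∑ i, ‖g i‖ * p i = ∑ i, r i * p i ^ 2 :=
      Finset.sum_congr rfl fun i _ => by rw [hg]; ring
    rw [Matrix.mulVec_diagonal, h2, Pi.star_apply, RCLike.star_def,
      mul_left_comm, ← Complex.normSq_eq_conj_mul_self, ← Complex.ofReal_mul, Complex.ofReal_re,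
      Complex.normSq_eq_norm_sq]
    ring
  rw [h1, Complex.normSq_eq_norm_sq]
  have h3 : ‖star g ⬝ᵥ x‖ ≤ ∑ l, r l * p l * ‖x l‖ := by
    refine (norm_sum_le _ _).trans (le_of_eq (Finset.sum_congr rfl fun l _ => ?_))
    rw [norm_mul, Pi.star_apply, norm_star, hg]
  refine (pow_le_pow_left₀ (norm_nonneg _) h3 2).trans ?_
  exact Finset.sum_sq_le_sum_mul_sum_of_sq_le_mul _ (fun l _ => mul_nonneg (hr l) (sq_nonneg _))
    (fun l _ => mul_nonneg (hr l) (sq_nonneg _)) fun l _ => le_of_eq (by ring)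

/-- The value of a Kronecker product on a product vector. -/
lemma matInner_kronecker_outer {m : Type*} [Fintype m] {K : Matrix m m ℂ} {B : Matrix n n ℂ}
    (hK : K.IsHermitian) (z : m → ℂ) (y : n → ℂ) :
    matInner (K ⊗ₖ B) (outer fun p : m × n => y p.2 * z p.1) =
      matInner K (outer z) * matInner B (outer y) := by
  have ho : (outer fun p : m × n => y p.2 * z p.1) = outer z ⊗ₖ outer y := by
    ext p q
    simp only [outer, Matrix.vecMulVec_apply, Matrix.kroneckerMap_apply, Pi.star_apply, star_mul']
    ring
  -- One factor must be real for the real part of the product of traces to split.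
  have him : (Matrix.trace (K.conjTranspose * outer z)).im = 0 := by
    rw [← Complex.conj_eq_iff_im, ← RCLike.star_def, ← Matrix.trace_conjTranspose,
      Matrix.conjTranspose_mul, Matrix.conjTranspose_conjTranspose, (isHermitian_outer z).eq,
      Matrix.trace_mul_comm, hK.eq]
  rw [matInner, ho, Matrix.conjTranspose_kronecker, ← Matrix.mul_kronecker_mul,
    Matrix.trace_kronecker, Complex.mul_re, him, zero_mul, sub_zero]
  rfl

end Quadratic

/-! ### Water-filling over two antennas. -/

/-- One coordinate of the maximizer of `h p + h' p'` under `p² ≤ P`, `p'² ≤ P'` and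
`p² + p'² ≤ P₀`. -/
noncomputable def waterLevel (h h' P₀ P P' : ℝ) : ℝ :=
  if 0 ≤ P₀ - P - P' then √P
  else if 0 ≤ P * (h * h + h' * h') - P₀ * (h * h) then
    if 0 ≤ P' * (h * h + h' * h') - P₀ * (h' * h') then √P₀ * h / √(h * h + h' * h')
    else √(P₀ - P')
  else √P

/-- `(p, p')` maximizes `h p + h' p'` under `p² ≤ P`, `p'² ≤ P'` and `p² + p'² ≤ P₀`, with
Lagrange multipliers `r, r'`. -/
def IsWaterFilling (h h' P₀ P P' p p' : ℝ) : Prop :=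
  p ^ 2 ≤ P ∧ p' ^ 2 ≤ P' ∧ p ^ 2 + p' ^ 2 ≤ P₀ ∧
    ∃ r r' : ℝ, 0 ≤ r ∧ 0 ≤ r' ∧ h = r * p ∧ h' = r' * p' ∧
      ∀ q q' : ℝ, q ≤ P → q' ≤ P' → q + q' ≤ P₀ → r * q + r' * q' ≤ h * p + h' * p'

lemma IsWaterFilling.symm {h h' P₀ P P' p p' : ℝ} (H : IsWaterFilling h h' P₀ P P' p p') :
    IsWaterFilling h' h P₀ P' P p' p := by
  obtain ⟨h1, h2, h3, r, r', hr, hr', e, e', hq⟩ := H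
  refine ⟨h2, h1, by linarith, r', r, hr', hr, e', e, fun q q' h4 h5 h6 => ?_⟩
  linarith [hq q' q h5 h4 (by linarith)]

/-- The proportional allocation would exceed the first cap, so that antenna is filled and the rest
of the budget goes to the other. With multipliers r ≥ r', write r q + r' q' = (r - r') q + r'(q +
q') and bound both terms by their constraints. -/
lemma isWaterFilling_of_saturated {h h' P₀ P P' : ℝ} (hh : 0 ≤ h) (hh' : 0 ≤ h') (hP : 0 < P)
    (hP₀ : P₀ < P + P') (hsat : P * (h * h + h' * h') < P₀ * (h * h)) :
    IsWaterFilling h h' P₀ P P' √P √(P₀ - P) := by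
  have hpos : 0 < P₀ - P := by
    by_contra hcon
    nlinarith [mul_nonneg hh hh, mul_nonneg hh' hh']
  have s1 := Real.sqrt_pos.mpr hP
  have s2 := Real.sqrt_pos.mpr hpos
  have e1 := Real.sq_sqrt hP.le
  have e2 := Real.sq_sqrt hpos.le
  set p := √P
  set p' := √(P₀ - P)
  refine ⟨e1.le, by linarith, by linarith, h / p, h' / p', by positivity, by positivity,
    (div_mul_cancel₀ _ s1.ne').symm, (div_mul_cancel₀ _ s2.ne').symm, fun q q' hq hq' hqq => ?_⟩
  have hslope : h' / p' ≤ h / p := by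
    rw [div_le_div_iff₀ s2 s1]
    refine abs_le_of_sq_le_sq' ?_ (by positivity) |>.2
    rw [mul_pow, mul_pow, e1, e2]
    nlinarith
  have hr' : 0 ≤ h' / p' := by positivity
  have e3 : h * p = h / p * P := by rw [← e1]; field_simp
  have e4 : h' * p' = h' / p' * (P₀ - P) := by rw [← e2]; field_simp
  rw [e3, e4]
  nlinarith

lemma isWaterFilling_waterLevel {h h' P₀ P P' : ℝ} (hh : 0 ≤ h) (hh' : 0 ≤ h') (hP₀ : 0 < P₀)
    (hP : 0 < P) (hP' : 0 < P') :
    IsWaterFilling h h' P₀ P P' (waterLevel h h' P₀ P P') (waterLevel h' h P₀ P' P) := by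
  have s1 := Real.sqrt_pos.mpr hP
  have s2 := Real.sqrt_pos.mpr hP'
  have e1 := Real.sq_sqrt hP.le
  have e2 := Real.sq_sqrt hP'.le
  by_cases c0 : 0 ≤ P₀ - P - P'
  · have c0' : 0 ≤ P₀ - P' - P := by linarith
    simp only [waterLevel, if_pos c0, if_pos c0']
    refine ⟨e1.le, e2.le, by linarith, h / √P, h' / √P', by positivity, by positivity,
      (div_mul_cancel₀ _ s1.ne').symm, (div_mul_cancel₀ _ s2.ne').symm, fun q q' hq hq' _ => ?_⟩
    have e3 : h * √P = h / √P * P := by nth_rw 3 [← e1]; field_simp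
    have e4 : h' * √P' = h' / √P' * P' := by nth_rw 3 [← e2]; field_simp
    rw [e3, e4]
    exact add_le_add (mul_le_mul_of_nonneg_left hq (by positivity))
      (mul_le_mul_of_nonneg_left hq' (by positivity))
  have c0' : ¬ 0 ≤ P₀ - P' - P := fun hc => c0 (by linarith)
  simp only [waterLevel, if_neg c0, if_neg c0', add_comm (h' * h') (h * h)]
  by_cases c1 : 0 ≤ P * (h * h + h' * h') - P₀ * (h * h) <;>
    by_cases c2 : 0 ≤ P' * (h * h + h' * h') - P₀ * (h' * h')
  · simp only [if_pos c1, if_pos c2]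
    set H := h * h + h' * h' with hH
    -- For a zero channel the levels are 0/0 = 0, and zero multipliers certify optimality.
    rcases (show 0 ≤ H by positivity).eq_or_lt with hH0 | hH0
    · have z1 : h = 0 := by nlinarith
      have z2 : h' = 0 := by nlinarith
      refine ⟨by simp [z1]; exact hP.le, by simp [z2]; exact hP'.le, by simp [z1, z2]; exact hP₀.le,
        0, 0, le_rfl, le_rfl, by simp [z1], by simp [z2], fun q q' _ _ _ => by simp [z1, z2]⟩
    · have t1 := Real.sqrt_pos.mpr hH0
      have t2 := Real.sqrt_pos.mpr hP₀
      have f1 := Real.sq_sqrt hH0.le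
      have f2 := Real.sq_sqrt hP₀.le
      refine ⟨?_, ?_, ?_, √H / √P₀, √H / √P₀, by positivity, by positivity, by field_simp,
        by field_simp, fun q q' _ _ hqq => ?_⟩
      · rw [div_pow, mul_pow, f1, f2, div_le_iff₀ hH0]; linarith
      · rw [div_pow, mul_pow, f1, f2, div_le_iff₀ hH0]; linarith
      · rw [div_pow, div_pow, mul_pow, mul_pow, f1, f2, ← add_div, div_le_iff₀ hH0, hH]
        linarith
      · rw [← mul_add]
        have : h * (√P₀ * h / √H) + h' * (√P₀ * h' / √H) = √H / √P₀ * P₀ := by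
          have : h * (√P₀ * h / √H) + h' * (√P₀ * h' / √H) = √P₀ * H / √H := by rw [hH]; ring
          rw [this]
          nth_rw 1 [← f1]
          nth_rw 3 [← f2]
          field_simp
        rw [this]
        exact mul_le_mul_of_nonneg_left hqq (by positivity)
  · simp only [if_pos c1, if_neg c2]
    exact (isWaterFilling_of_saturated hh' hh hP' (by linarith) (by linarith)).symm
  · simp only [if_neg c1, if_pos c2]
    exact isWaterFilling_of_saturated hh hh' hP (by linarith) (by linarith)
  -- Both caps cannot be exceeded: adding the two inequalities would give P + P' < P₀.
  · nlinarith [mul_nonneg hh hh, mul_nonneg hh' hh']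

/-! ### Optimality of a matched beamformer for a single user. -/

namespace RelayNetwork

variable {G : ℕ} {m : Fin G → ℕ} {L : ℕ} (S : RelayNetwork G m L)

lemma outer_chan (j : Fin G) (u : Σ k, Fin (m k)) :
    outer (S.chan j u) = outer (star (S.f j)) ⊗ₖ outer (S.g u) := by
  ext p q
  simp only [outer, chan, Matrix.vecMulVec_apply, Matrix.kroneckerMap_apply, Pi.star_apply,
    star_mul', RCLike.star_def]
  ring

/-- Signal, interference and noise of a user add up to the total received power. -/
lemma A_add_C (u : Σ k, Fin (m k)) :
    S.A u + S.C u = ((1 / S.σU u ^ 2 : ℝ) : ℂ) • (S.rxCov ⊗ₖ outer (S.g u)) := by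
  have hsum : ∑ j, ((S.P j / S.σU u ^ 2 : ℝ) : ℂ) • outer (S.chan j u) = S.A u +
      ∑ j ∈ Finset.univ.filter (fun j => j ≠ u.1),
        ((S.P j / S.σU u ^ 2 : ℝ) : ℂ) • outer (S.chan j u) := by
    rw [Finset.filter_ne']
    exact (Finset.add_sum_erase Finset.univ
      (fun j => ((S.P j / S.σU u ^ 2 : ℝ) : ℂ) • outer (S.chan j u)) (Finset.mem_univ u.1)).symm
  rw [C, ← add_assoc, ← hsum, rxCov, Matrix.add_kronecker, smul_add]
  congr 1
  ext p q
  simp only [Matrix.smul_apply, Matrix.sum_apply, Matrix.kroneckerMap_apply, smul_eq_mul,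
    Finset.sum_mul, Finset.mul_sum, outer_chan]
  refine Finset.sum_congr rfl fun j _ => ?_
  push_cast
  ring

/-- Total power is the sum of the antenna powers, which makes the total threshold the budget P₀ of
the water-filling problem. -/
lemma D_none_eq : S.D none = ∑ l, S.D (some l) := by
  ext p q
  simp only [D, Matrix.sum_apply, Matrix.kroneckerMap_apply, ← Finset.mul_sum]
  congr 1
  simp [Matrix.single_apply, Matrix.one_apply, ite_and]

lemma kronecker_diagonal_eq (d : Fin L → ℝ) :
    S.rxCov ⊗ₖ Matrix.diagonal (fun l => (d l : ℂ)) = ∑ l, (d l : ℂ) • S.D (some l) := by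
  ext p q
  simp only [D, Matrix.sum_apply, Matrix.kroneckerMap_apply, Matrix.smul_apply, smul_eq_mul]
  simp only [mul_left_comm _ (S.rxCov p.1 q.1), ← Finset.mul_sum]
  congr 1
  simp [Matrix.single_apply, Matrix.diagonal_apply, ite_and]

/-- The received power of a user is at most `(∑ₗ |gₗ| pₗ)²` for the best antenna amplitudes `p`. -/
lemma matInner_kronecker_le {W : Matrix (VecIdx L) (VecIdx L) ℂ} (hW : W ∈ S.sdrFeasible)
    (u : Σ k, Fin (m k)) {p r : Fin L → ℝ} (hp : 0 ≤ ∑ l, ‖S.g u l‖ * p l) (hr : ∀ l, 0 ≤ r l)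
    (hg : ∀ l, ‖S.g u l‖ = r l * p l)
    (hq : ∀ q : Fin L → ℝ, (∀ l, q l ≤ S.Pbar (some l)) → ∑ l, q l ≤ S.Pbar none →
      ∑ l, r l * q l ≤ ∑ l, ‖S.g u l‖ * p l) :
    matInner (S.rxCov ⊗ₖ outer (S.g u)) W ≤ (∑ l, ‖S.g u l‖ * p l) ^ 2 := by
  have h1 := S.posDef_rxCov.posSemidef.kronecker (posSemidef_diagonal_sub_outer hr hg)
  rw [show ∀ M N : Matrix (Fin L) (Fin L) ℂ, S.rxCov ⊗ₖ (M - N) = S.rxCov ⊗ₖ M - S.rxCov ⊗ₖ N from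
    fun M N => by ext; simp [mul_sub]] at h1
  refine (matInner_le_matInner h1 hW.1).trans ?_
  rw [kronecker_diagonal_eq, matInner_sum_left]
  simp only [matInner_smul_left, mul_assoc]
  rw [← Finset.mul_sum, pow_two]
  refine mul_le_mul_of_nonneg_left (hq _ (fun l => hW.2 (some l)) ?_) hp
  rw [← matInner_sum_left, ← D_none_eq]
  exact hW.2 none

/-- A matched relay beamformer is optimal for a single user. -/
lemma isSDROptimal_matched (u : Σ k, Fin (m k)) (hu : ∀ v, v = u) {p r : Fin L → ℝ}
    (hp : 0 ≤ ∑ l, ‖S.g u l‖ * p l) (hr : ∀ l, 0 ≤ r l) (hg : ∀ l, ‖S.g u l‖ = r l * p l)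
    (hP : ∀ l, p l ^ 2 ≤ S.Pbar (some l)) (hP₀ : ∑ l, p l ^ 2 ≤ S.Pbar none)
    (hq : ∀ q : Fin L → ℝ, (∀ l, q l ≤ S.Pbar (some l)) → ∑ l, q l ≤ S.Pbar none →
      ∑ l, r l * q l ≤ ∑ l, ‖S.g u l‖ * p l)
    {z : Fin L → ℂ} (hz : matInner S.rxCov (outer z) ≤ 1)
    (hf : S.f u.1 = 0 ∨ ∃ s : ℝ, 0 < s ∧ S.rxCov.mulVec z = (s : ℂ) • star (S.f u.1) ∧
      star z ⬝ᵥ S.rxCov.mulVec z = 1) :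
    S.IsSDROptimal (outer fun i => (p i.2 : ℂ) * (S.g u i.2 / (‖S.g u i.2‖ : ℂ)) * z i.1) := by
  have hKH := S.posDef_rxCov.isHermitian
  set y : Fin L → ℂ := fun l => (p l : ℂ) * (S.g u l / (‖S.g u l‖ : ℂ)) with hy
  set w : VecIdx L → ℂ := fun i => y i.2 * z i.1 with hw
  have hylt : ∀ l, Complex.normSq (y l) ≤ p l ^ 2 := by
    intro l
    simp only [hy, map_mul, map_div₀, Complex.normSq_eq_norm_sq, Complex.norm_real,
      Real.norm_eq_abs, sq_abs]
    by_cases h0 : ‖S.g u l‖ = 0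
    -- An antenna with zero gain gets phase 0/0 = 0, hence no power; therefore only an inequality is
    -- claimed.
    · simp [h0]; positivity
    · rw [div_self (pow_ne_zero 2 h0), mul_one]
  have hDl : ∀ l, matInner (S.D (some l)) (outer w) ≤ p l ^ 2 := by
    intro l
    have : matInner (Matrix.single l l (1 : ℂ)) (outer y) = Complex.normSq (y l) := by
      rw [matInner_outer_right _ _ (by simp [Matrix.IsHermitian])]
      have h1 : (Matrix.single l l (1 : ℂ)).mulVec y = Pi.single l (y l) := by
        rw [Matrix.single_mulVec, one_mul]
        rfl
      rw [h1, dotProduct_single, Pi.star_apply, RCLike.star_def, ← Complex.normSq_eq_conj_mul_self,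
        Complex.ofReal_re]
    rw [D, matInner_kronecker_outer hKH, this]
    exact (mul_le_of_le_one_left (Complex.normSq_nonneg _) hz).trans (hylt l)
  have hfeas : outer w ∈ S.sdrFeasible := by
    refine ⟨posSemidef_outer w, fun l => ?_⟩
    cases l with
    | some l => exact (hDl l).trans (hP l)
    | none =>
      rw [D_none_eq, matInner_sum_left]
      exact (Finset.sum_le_sum fun l _ => hDl l).trans hP₀
  have hgam : ∀ W, S.gam W = matInner (S.A u) W / (matInner (S.C u) W + 1) := by
    intro W
    have : Unique (Σ k, Fin (m k)) := ⟨⟨u⟩, hu⟩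
    rw [gam, ciInf_unique, hu default]
  refine ⟨hfeas, fun W hW => ?_⟩
  rw [hgam, hgam]
  have hC : ∀ W, matInner (S.C u) W =
      1 / S.σU u ^ 2 * matInner (S.rxCov ⊗ₖ outer (S.g u)) W - matInner (S.A u) W := by
    intro W
    rw [← matInner_smul_left, ← A_add_C, matInner_add_left]
    ring
  -- If the transmitter channel is zero, the signal vanishes and every feasible point is optimal.
  rcases hf with hf | ⟨s, hs, hKz, hzz⟩
  · have hA : S.A u = 0 := by
      ext
      simp [A, outer, Matrix.vecMulVec_apply, chan, hf]
    simp [hA, matInner]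
  have hT : matInner (outer (S.g u)) (outer y) = (∑ l, ‖S.g u l‖ * p l) ^ 2 := by
    have : star (S.g u) ⬝ᵥ y = ((∑ l, ‖S.g u l‖ * p l : ℝ) : ℂ) := by
      rw [dotProduct]
      push_cast
      refine Finset.sum_congr rfl fun l _ => ?_
      simp only [hy, Pi.star_apply, RCLike.star_def]
      by_cases h0 : S.g u l = 0
      · simp [h0]
      · have h1 : (‖S.g u l‖ : ℂ) ≠ 0 := by simpa using h0
        rw [mul_left_comm, ← mul_div_assoc, ← Complex.normSq_eq_conj_mul_self,
          Complex.normSq_eq_norm_sq]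
        push_cast
        field_simp
    rw [matInner_outer_outer, this, Complex.normSq_ofReal, pow_two]
  have hQ : matInner (S.rxCov ⊗ₖ outer (S.g u)) (outer w) = (∑ l, ‖S.g u l‖ * p l) ^ 2 := by
    rw [matInner_kronecker_outer hKH, hT, matInner_outer_right _ _ hKH, hzz, Complex.one_re,
      one_mul]
  have hQW := S.matInner_kronecker_le hW u hp hr hg hq
  have hsig : ∀ W, matInner (S.A u) W = S.P u.1 / S.σU u ^ 2 *
      matInner (outer (star (S.f u.1)) ⊗ₖ outer (S.g u)) W := by
    intro W
    rw [A, matInner_smul_left, outer_chan]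
  have hφz : matInner (outer (star (S.f u.1))) (outer z) = 1 / s ^ 2 := by
    rw [hKz, dotProduct_smul, smul_eq_mul] at hzz
    have hs' : (s : ℂ) ≠ 0 := by exact_mod_cast hs.ne'
    have h1 : star z ⬝ᵥ star (S.f u.1) = ((1 / s : ℝ) : ℂ) := by
      push_cast
      rw [eq_div_iff hs', mul_comm]
      exact hzz
    have h2 : S.f u.1 ⬝ᵥ z = conj (star z ⬝ᵥ star (S.f u.1)) := by
      simp [dotProduct, map_sum, mul_comm]
    rw [matInner_outer_outer, star_star, h2, Complex.normSq_conj, h1, Complex.normSq_ofReal]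
    ring
  have hAw : s ^ 2 * matInner (outer (star (S.f u.1)) ⊗ₖ outer (S.g u)) (outer w) =
      matInner (S.rxCov ⊗ₖ outer (S.g u)) (outer w) := by
    rw [hQ, matInner_kronecker_outer (isHermitian_outer _), hT, hφz]
    field_simp
  have hAW : s ^ 2 * matInner (outer (star (S.f u.1)) ⊗ₖ outer (S.g u)) W ≤
      matInner (S.rxCov ⊗ₖ outer (S.g u)) W := by
    have h1 := (posSemidef_sub_outer_of_mulVec_eq S.posDef_rxCov.posSemidef hKz hzz).kronecker
      (posSemidef_outer (S.g u))
    rw [show ∀ M N B : Matrix (Fin L) (Fin L) ℂ, (M - N) ⊗ₖ B = M ⊗ₖ B - N ⊗ₖ B from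
      fun M N B => by ext; simp [sub_mul], Matrix.smul_kronecker] at h1
    have h2 := matInner_le_matInner h1 hW.1
    rwa [matInner_smul_left] at h2
  have hdW : 0 < matInner (S.C u) W + 1 :=
    add_pos_of_nonneg_of_pos (matInner_nonneg (S.posSemidef_C u) hW.1) one_pos
  have hdw : 0 < matInner (S.C u) (outer w) + 1 :=
    add_pos_of_nonneg_of_pos (matInner_nonneg (S.posSemidef_C u) (posSemidef_outer w)) one_pos
  rw [div_le_div_iff₀ hdW hdw]
  rw [hC, hC, hsig, hsig]
  have hP0 : 0 ≤ S.P u.1 / S.σU u ^ 2 := div_nonneg (S.P_nonneg _) (sq_nonneg _)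
  have hσ : 0 ≤ 1 / S.σU u ^ 2 := by positivity
  rw [← hQ] at hQW
  set Q := matInner (S.rxCov ⊗ₖ outer (S.g u)) (outer w)
  set Q' := matInner (S.rxCov ⊗ₖ outer (S.g u)) W
  set a := matInner (outer (star (S.f u.1)) ⊗ₖ outer (S.g u)) (outer w)
  set a' := matInner (outer (star (S.f u.1)) ⊗ₖ outer (S.g u)) W
  set ρ := S.P u.1 / S.σU u ^ 2
  set c := 1 / S.σU u ^ 2
  have hs2 : 0 < s ^ 2 := by positivity
  have hQ0 : 0 ≤ Q := by rw [hQ]; positivity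
  -- After cross-multiplication the products of the two signal terms cancel, so comparing SINRs
  -- means comparing signal over total received power plus one. The bounds s²a' ≤ Q' ≤ Q and the
  -- equality s²a = Q settle it.
  have key : a' * (c * Q + 1) ≤ a * (c * Q' + 1) := by
    refine le_of_mul_le_mul_left (a := s ^ 2) ?_ hs2
    calc s ^ 2 * (a' * (c * Q + 1)) = (s ^ 2 * a') * (c * Q + 1) := by ring
      _ ≤ Q' * (c * Q + 1) := mul_le_mul_of_nonneg_right hAW (by positivity)
      _ ≤ Q * (c * Q' + 1) := by linarith
      _ = s ^ 2 * (a * (c * Q' + 1)) := by rw [← hAw]; ring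
  have := mul_le_mul_of_nonneg_left key hP0
  linarith

end RelayNetwork

/-! ### Closed form of the optimal beamformer for two antennas; in `Fin 2`, `c + 1` is the other
index. -/

namespace RelayNetwork

variable {G : ℕ} {m : Fin G → ℕ}

/-- The vector `adj(K) f^*` for the received covariance `K` of a relay with two antennas. -/
noncomputable def matchedDir (u : Σ k, Fin (m k)) (S : RelayNetwork G m 2) (c : Fin 2) : ℂ :=
  S.rxCov (c + 1) (c + 1) * conj (S.f u.1 c) - S.rxCov c (c + 1) * conj (S.f u.1 (c + 1))

/-- The squared norm `zᴴ K z` of `z = adj(K) f^*`. -/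
noncomputable def matchedNormSq (u : Σ k, Fin (m k)) (S : RelayNetwork G m 2) : ℝ :=
  (conj (matchedDir u S 0) * (S.rxCov 0 0 * matchedDir u S 0 + S.rxCov 0 1 * matchedDir u S 1) +
    conj (matchedDir u S 1) * (S.rxCov 1 0 * matchedDir u S 0 + S.rxCov 1 1 * matchedDir u S 1)).re

/-- The vector `adj(K) f^*`, normalized in the norm of `K`. -/
noncomputable def matchedUnit (u : Σ k, Fin (m k)) (S : RelayNetwork G m 2) (c : Fin 2) : ℂ :=
  matchedDir u S c / ((√(matchedNormSq u S) : ℝ) : ℂ)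

/-- The optimal amplitude of an antenna. -/
noncomputable def antennaLevel (u : Σ k, Fin (m k)) (S : RelayNetwork G m 2) (r : Fin 2) : ℝ :=
  waterLevel ‖S.g u r‖ ‖S.g u (r + 1)‖ (S.Pbar none) (S.Pbar (some r)) (S.Pbar (some (r + 1)))

/-- The optimal beamformer for a relay with two antennas and a single user. -/
noncomputable def optVec (u : Σ k, Fin (m k)) (S : RelayNetwork G m 2) (i : VecIdx 2) : ℂ :=
  (antennaLevel u S i.2 : ℂ) * (S.g u i.2 / (‖S.g u i.2‖ : ℂ)) * matchedUnit u S i.1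

lemma rxCov_mulVec_matchedDir (u : Σ k, Fin (m k)) (S : RelayNetwork G m 2) :
    S.rxCov.mulVec (matchedDir u S) = S.rxCov.det • star (S.f u.1) := by
  ext i
  rw [Matrix.det_fin_two]
  fin_cases i <;>
  · simp [Matrix.mulVec, dotProduct, Fin.sum_univ_two, matchedDir]
    ring

lemma matchedNormSq_eq (u : Σ k, Fin (m k)) (S : RelayNetwork G m 2) :
    matchedNormSq u S = matInner S.rxCov (outer (matchedDir u S)) := by
  rw [matInner_outer_right _ _ S.posDef_rxCov.isHermitian]
  simp [matchedNormSq, Matrix.mulVec, dotProduct, Fin.sum_univ_two]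

lemma matchedUnit_eq_smul (u : Σ k, Fin (m k)) (S : RelayNetwork G m 2) :
    matchedUnit u S = (((√(matchedNormSq u S))⁻¹ : ℝ) : ℂ) • matchedDir u S := by
  ext c
  simp [matchedUnit, div_eq_inv_mul]

/-- The quotient is left unsimplified to cover a zero channel, where it is 0/0 = 0 and the bound by
1 needed for feasibility still holds. -/
lemma matInner_matchedUnit (u : Σ k, Fin (m k)) (S : RelayNetwork G m 2) :
    matInner S.rxCov (outer (matchedUnit u S)) = matchedNormSq u S / matchedNormSq u S := by
  have hn0 : 0 ≤ matchedNormSq u S := by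
    rw [matchedNormSq_eq]
    exact matInner_nonneg S.posDef_rxCov.posSemidef (posSemidef_outer _)
  rw [matchedUnit_eq_smul, matInner_outer_smul, Complex.normSq_ofReal, ← mul_inv,
    Real.mul_self_sqrt hn0, ← matchedNormSq_eq, inv_mul_eq_div]

lemma matchedUnit_spec (u : Σ k, Fin (m k)) (S : RelayNetwork G m 2) (hf : S.f u.1 ≠ 0) :
    ∃ s : ℝ, 0 < s ∧ S.rxCov.mulVec (matchedUnit u S) = (s : ℂ) • star (S.f u.1) ∧
      star (matchedUnit u S) ⬝ᵥ S.rxCov.mulVec (matchedUnit u S) = 1 := by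
  have hK := S.posDef_rxCov
  have hdet : 0 < S.rxCov.det := hK.det_pos
  have hdet' : S.rxCov.det = (S.rxCov.det.re : ℂ) :=
    Complex.ext rfl (Complex.lt_def.mp hdet).2.symm
  have hdetre : 0 < S.rxCov.det.re := (Complex.lt_def.mp hdet).1
  have hd0 : matchedDir u S ≠ 0 := by
    intro h0
    have := rxCov_mulVec_matchedDir u S
    rw [h0, Matrix.mulVec_zero, eq_comm, smul_eq_zero] at this
    rcases this with h | h
    · exact hdet.ne' h
    · exact hf (star_eq_zero.mp h)
  have hnpos : 0 < matchedNormSq u S := by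
    rw [matchedNormSq_eq, matInner_outer_right _ _ hK.isHermitian]
    exact (Complex.lt_def.mp (hK.dotProduct_mulVec_pos hd0)).1
  refine ⟨(√(matchedNormSq u S))⁻¹ * S.rxCov.det.re, by positivity, ?_, ?_⟩
  · rw [matchedUnit_eq_smul, Matrix.mulVec_smul, rxCov_mulVec_matchedDir, smul_smul, hdet',
      Complex.ofReal_re, ← Complex.ofReal_mul]
  · have hz := matInner_matchedUnit u S
    rw [matInner_outer_right _ _ hK.isHermitian, div_self hnpos.ne'] at hz
    exact Complex.ext hz (hK.isHermitian.im_star_dotProduct_mulVec_self (matchedUnit u S))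

lemma isSDROptimal_optVec (u : Σ k, Fin (m k)) (hu : ∀ v, v = u) (S : RelayNetwork G m 2) :
    S.IsSDROptimal (outer (optVec u S)) := by
  obtain ⟨h1, h2, h3, r, r', hr, hr', e, e', hq⟩ := isWaterFilling_waterLevel (norm_nonneg (S.g u 0))
    (norm_nonneg (S.g u 1)) (S.Pbar_pos none) (S.Pbar_pos (some 0)) (S.Pbar_pos (some 1))
  have l0 : waterLevel ‖S.g u 0‖ ‖S.g u 1‖ (S.Pbar none) (S.Pbar (some 0)) (S.Pbar (some 1)) =
    antennaLevel u S 0 := by rw [antennaLevel, zero_add]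
  have l1 : waterLevel ‖S.g u 1‖ ‖S.g u 0‖ (S.Pbar none) (S.Pbar (some 1)) (S.Pbar (some 0)) =
    antennaLevel u S 1 := by rw [antennaLevel, show (1 + 1 : Fin 2) = 0 from rfl]
  rw [l0] at h1 h3 e hq
  rw [l1] at h2 h3 e' hq
  have hpos : 0 ≤ ∑ l, ‖S.g u l‖ * antennaLevel u S l := by
    rw [Fin.sum_univ_two, e, e', mul_assoc, mul_assoc]
    exact add_nonneg (mul_nonneg hr (mul_self_nonneg _)) (mul_nonneg hr' (mul_self_nonneg _))
  have hz : matInner S.rxCov (outer (matchedUnit u S)) ≤ 1 :=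
    (matInner_matchedUnit u S).trans_le (div_self_le_one _)
  have hr2 : ∀ l, 0 ≤ (![r, r'] : Fin 2 → ℝ) l := Fin.forall_fin_two.mpr ⟨hr, hr'⟩
  have hg2 : ∀ l, ‖S.g u l‖ = (![r, r'] : Fin 2 → ℝ) l * antennaLevel u S l :=
    Fin.forall_fin_two.mpr ⟨e, e'⟩
  have hP2 : ∀ l, antennaLevel u S l ^ 2 ≤ S.Pbar (some l) := Fin.forall_fin_two.mpr ⟨h1, h2⟩
  have hP₀ : ∑ l, antennaLevel u S l ^ 2 ≤ S.Pbar none := (Fin.sum_univ_two _).trans_le h3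
  have hq2 : ∀ q : Fin 2 → ℝ, (∀ l, q l ≤ S.Pbar (some l)) → ∑ l, q l ≤ S.Pbar none →
      ∑ l, (![r, r'] : Fin 2 → ℝ) l * q l ≤ ∑ l, ‖S.g u l‖ * antennaLevel u S l := by
    intro q hq1 hq2
    rw [Fin.sum_univ_two] at hq2 ⊢
    rw [Fin.sum_univ_two]
    exact hq (q 0) (q 1) (hq1 0) (hq1 1) hq2
  have hf : S.f u.1 = 0 ∨ ∃ s : ℝ, 0 < s ∧
      S.rxCov.mulVec (matchedUnit u S) = (s : ℂ) • star (S.f u.1) ∧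
      star (matchedUnit u S) ⬝ᵥ S.rxCov.mulVec (matchedUnit u S) = 1 :=
    or_iff_not_imp_left.mpr (matchedUnit_spec u S)
  have hw : optVec u S = fun i => (antennaLevel u S i.2 : ℂ) *
      (S.g u i.2 / (‖S.g u i.2‖ : ℂ)) * matchedUnit u S i.1 := rfl
  rw [hw]
  exact S.isSDROptimal_matched u hu hpos hr2 hg2 hP2 hP₀ hq2 hz hf

end RelayNetwork

/-! ### Computability of the closed form by real programs. -/

/-- A real quantity attached to relay networks with two antennas and a marked user is linearly
computable if, uniformly in the dimensions, it is the value of a program of size linear in the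
number of transmitters. -/
def LinComputable
    (F : ∀ (G : ℕ) (m : Fin G → ℕ), (Σ k, Fin (m k)) → RelayNetwork G m 2 → ℝ) : Prop :=
  ∃ c : ℕ, ∀ (G : ℕ) (m : Fin G → ℕ) (u : Σ k, Fin (m k)),
    ∃ p : RealProgram (NetworkInput G m 2), p.cost ≤ c * (G + 1) ∧
      ∀ S : RelayNetwork G m 2, p.eval S.encode = F G m u S

namespace LinComputable

variable {F H I : ∀ (G : ℕ) (m : Fin G → ℕ), (Σ k, Fin (m k)) → RelayNetwork G m 2 → ℝ}

lemma input (i : ∀ (G : ℕ) (m : Fin G → ℕ), (Σ k, Fin (m k)) → NetworkInput G m 2) :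
    LinComputable fun G m u S => S.encode (i G m u) :=
  ⟨1, fun G m u => ⟨.input (i G m u), by simp [RealProgram.cost], fun S => rfl⟩⟩

lemma const (q : ℚ) : LinComputable fun _ _ _ _ => (q : ℝ) :=
  ⟨1, fun G m u => ⟨.const q, by simp [RealProgram.cost], fun S => rfl⟩⟩

lemma add (hF : LinComputable F) (hH : LinComputable H) :
    LinComputable fun G m u S => F G m u S + H G m u S := by
  obtain ⟨c, hc⟩ := hF
  obtain ⟨d, hd⟩ := hH
  refine ⟨c + d + 1, fun G m u => ?_⟩
  obtain ⟨p, hp, hpe⟩ := hc G m u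
  obtain ⟨q, hq, hqe⟩ := hd G m u
  exact ⟨.add p q, by simp only [RealProgram.cost]; nlinarith,
    fun S => by simp only [RealProgram.eval, hpe, hqe]⟩

lemma sub (hF : LinComputable F) (hH : LinComputable H) :
    LinComputable fun G m u S => F G m u S - H G m u S := by
  obtain ⟨c, hc⟩ := hF
  obtain ⟨d, hd⟩ := hH
  refine ⟨c + d + 1, fun G m u => ?_⟩
  obtain ⟨p, hp, hpe⟩ := hc G m u
  obtain ⟨q, hq, hqe⟩ := hd G m u
  exact ⟨.sub p q, by simp only [RealProgram.cost]; nlinarith,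
    fun S => by simp only [RealProgram.eval, hpe, hqe]⟩

lemma mul (hF : LinComputable F) (hH : LinComputable H) :
    LinComputable fun G m u S => F G m u S * H G m u S := by
  obtain ⟨c, hc⟩ := hF
  obtain ⟨d, hd⟩ := hH
  refine ⟨c + d + 1, fun G m u => ?_⟩
  obtain ⟨p, hp, hpe⟩ := hc G m u
  obtain ⟨q, hq, hqe⟩ := hd G m u
  exact ⟨.mul p q, by simp only [RealProgram.cost]; nlinarith,
    fun S => by simp only [RealProgram.eval, hpe, hqe]⟩

lemma div (hF : LinComputable F) (hH : LinComputable H) :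
    LinComputable fun G m u S => F G m u S / H G m u S := by
  obtain ⟨c, hc⟩ := hF
  obtain ⟨d, hd⟩ := hH
  refine ⟨c + d + 1, fun G m u => ?_⟩
  obtain ⟨p, hp, hpe⟩ := hc G m u
  obtain ⟨q, hq, hqe⟩ := hd G m u
  exact ⟨.div p q, by simp only [RealProgram.cost]; nlinarith,
    fun S => by simp only [RealProgram.eval, hpe, hqe]⟩

lemma sqrt (hF : LinComputable F) : LinComputable fun G m u S => √(F G m u S) := by
  obtain ⟨c, hc⟩ := hF
  refine ⟨c + 1, fun G m u => ?_⟩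
  obtain ⟨p, hp, hpe⟩ := hc G m u
  exact ⟨.sqrt p, by simp only [RealProgram.cost]; nlinarith,
    fun S => by simp only [RealProgram.eval, hpe]⟩

lemma ite (hI : LinComputable I) (hF : LinComputable F) (hH : LinComputable H) :
    LinComputable fun G m u S => if 0 ≤ I G m u S then F G m u S else H G m u S := by
  obtain ⟨b, hb⟩ := hI
  obtain ⟨c, hc⟩ := hF
  obtain ⟨d, hd⟩ := hH
  refine ⟨b + c + d + 1, fun G m u => ?_⟩
  obtain ⟨r, hr, hre⟩ := hb G m u
  obtain ⟨p, hp, hpe⟩ := hc G m u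
  obtain ⟨q, hq, hqe⟩ := hd G m u
  exact ⟨.ifNonneg r p q, by simp only [RealProgram.cost]; nlinarith,
    fun S => by simp only [RealProgram.eval, hre, hpe, hqe]⟩

end LinComputable

/-- The sum of a family of programs. -/
lemma RealProgram.exists_sum {ι : Type} (c : ℕ) : ∀ (n : ℕ) (p : Fin n → RealProgram ι),
    (∀ j, (p j).cost ≤ c) →
      ∃ q : RealProgram ι, q.cost ≤ n * (c + 1) + 1 ∧ ∀ x, q.eval x = ∑ j, (p j).eval x
  | 0, _, _ => ⟨.const 0, by simp [cost], fun x => by simp [eval]⟩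
  | n + 1, p, hp => by
    obtain ⟨q, hq, hqe⟩ := exists_sum c n (fun j => p j.succ) fun j => hp _
    refine ⟨.add (p 0) q, ?_, fun x => ?_⟩
    · have := hp 0
      simp only [cost]
      nlinarith
    · rw [Fin.sum_univ_succ, ← hqe]
      rfl

/-- Complex quantities with linearly computable real and imaginary parts. -/
def CLinComputable
    (F : ∀ (G : ℕ) (m : Fin G → ℕ), (Σ k, Fin (m k)) → RelayNetwork G m 2 → ℂ) : Prop :=
  LinComputable (fun G m u S => (F G m u S).re) ∧ LinComputable (fun G m u S => (F G m u S).im)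

namespace CLinComputable

variable {F H : ∀ (G : ℕ) (m : Fin G → ℕ), (Σ k, Fin (m k)) → RelayNetwork G m 2 → ℂ}
  {R : ∀ (G : ℕ) (m : Fin G → ℕ), (Σ k, Fin (m k)) → RelayNetwork G m 2 → ℝ}

lemma add (hF : CLinComputable F) (hH : CLinComputable H) :
    CLinComputable fun G m u S => F G m u S + H G m u S :=
  ⟨hF.1.add hH.1, hF.2.add hH.2⟩

lemma sub (hF : CLinComputable F) (hH : CLinComputable H) :
    CLinComputable fun G m u S => F G m u S - H G m u S :=
  ⟨hF.1.sub hH.1, hF.2.sub hH.2⟩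

lemma mul (hF : CLinComputable F) (hH : CLinComputable H) :
    CLinComputable fun G m u S => F G m u S * H G m u S :=
  ⟨(hF.1.mul hH.1).sub (hF.2.mul hH.2), (hF.1.mul hH.2).add (hF.2.mul hH.1)⟩

lemma star (hF : CLinComputable F) :
    CLinComputable fun G m u S => starRingEnd ℂ (F G m u S) := by
  refine ⟨hF.1, ?_⟩
  simpa using (LinComputable.const 0).sub hF.2

lemma ofReal (hR : LinComputable R) : CLinComputable fun G m u S => (R G m u S : ℂ) := by
  refine ⟨hR, ?_⟩
  simpa using LinComputable.const 0

lemma div_ofReal (hF : CLinComputable F) (hR : LinComputable R) :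
    CLinComputable fun G m u S => F G m u S / (R G m u S : ℂ) := by
  refine ⟨?_, ?_⟩
  · simpa only [Complex.div_ofReal_re] using hF.1.div hR
  · simpa only [Complex.div_ofReal_im] using hF.2.div hR

lemma norm (hF : CLinComputable F) : LinComputable fun G m u S => ‖F G m u S‖ := by
  simpa only [Complex.norm_def, Complex.normSq_apply] using
    ((hF.1.mul hF.1).add (hF.2.mul hF.2)).sqrt

lemma f (c : Fin 2) : CLinComputable fun _ _ u S => S.f u.1 c :=
  ⟨.input fun _ _ u => .fRe u.1 c, .input fun _ _ u => .fIm u.1 c⟩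

lemma g (c : Fin 2) : CLinComputable fun _ _ u S => S.g u c :=
  ⟨.input fun _ _ u => .gRe u c, .input fun _ _ u => .gIm u c⟩

lemma rxCov (c d : Fin 2) : CLinComputable fun _ _ _ S => S.rxCov c d := by
  have hsum : CLinComputable fun _ _ _ S => ∑ j, (S.P j : ℂ) * (starRingEnd ℂ (S.f j c) * S.f j d) := by
    refine ⟨⟨20, fun G m u => ?_⟩, ⟨20, fun G m u => ?_⟩⟩
    -- Each summand is a program with 9 instructions, so the sum costs at most 10G + 1.
    · obtain ⟨q, hq, hqe⟩ := RealProgram.exists_sum 9 G (fun j =>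
        (.mul (.input (.power j)) (.add (.mul (.input (.fRe j c)) (.input (.fRe j d)))
          (.mul (.input (.fIm j c)) (.input (.fIm j d)))) : RealProgram (NetworkInput G m 2)))
        fun j => by simp [RealProgram.cost]
      refine ⟨q, by omega, fun S => ?_⟩
      simp only [hqe, Complex.re_sum]
      refine Finset.sum_congr rfl fun j _ => ?_
      simp [RealProgram.eval, RelayNetwork.encode]
    · obtain ⟨q, hq, hqe⟩ := RealProgram.exists_sum 9 G (fun j =>
        (.mul (.input (.power j)) (.sub (.mul (.input (.fRe j c)) (.input (.fIm j d)))
          (.mul (.input (.fIm j c)) (.input (.fRe j d)))) : RealProgram (NetworkInput G m 2)))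
        fun j => by simp [RealProgram.cost]
      refine ⟨q, by omega, fun S => ?_⟩
      simp only [hqe, Complex.im_sum]
      refine Finset.sum_congr rfl fun j _ => ?_
      simp only [RealProgram.eval, RelayNetwork.encode, Complex.ofReal_re, Complex.ofReal_im, Complex.mul_im,
        Complex.conj_re, Complex.conj_im]
      ring
  have hnoise : CLinComputable fun _ _ _ S => S.noiseCov c d := by
    by_cases h : c = d
    · subst h
      have := CLinComputable.ofReal ((LinComputable.input fun _ _ _ => .sigmaR c).mul
        (.input fun _ _ _ => .sigmaR c))
      simpa [RelayNetwork.noiseCov, pow_two, RelayNetwork.encode] using this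
    · simpa [RelayNetwork.noiseCov, h] using CLinComputable.ofReal (LinComputable.const 0)
  have := hsum.add hnoise
  simpa only [RelayNetwork.rxCov, outer, Matrix.add_apply, Matrix.sum_apply, Matrix.smul_apply,
    Matrix.vecMulVec_apply, Pi.star_apply, star_star, smul_eq_mul, RCLike.star_def] using this

lemma matchedDir (c : Fin 2) : CLinComputable fun _ _ u S => RelayNetwork.matchedDir u S c :=
  ((rxCov _ _).mul (f c).star).sub ((rxCov _ _).mul (f _).star)

end CLinComputable

namespace LinComputable

lemma matchedNormSq : LinComputable fun _ _ u S => RelayNetwork.matchedNormSq u S :=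
  (CLinComputable.add
    ((CLinComputable.matchedDir 0).star.mul
      (((CLinComputable.rxCov 0 0).mul (.matchedDir 0)).add ((CLinComputable.rxCov 0 1).mul (.matchedDir 1))))
    ((CLinComputable.matchedDir 1).star.mul
      (((CLinComputable.rxCov 1 0).mul (.matchedDir 0)).add
        ((CLinComputable.rxCov 1 1).mul (.matchedDir 1))))).1

lemma waterLevel {h h' P₀ P P' :
    ∀ (G : ℕ) (m : Fin G → ℕ), (Σ k, Fin (m k)) → RelayNetwork G m 2 → ℝ}
    (H : LinComputable h) (H' : LinComputable h') (K₀ : LinComputable P₀) (K : LinComputable P)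
    (K' : LinComputable P') : LinComputable fun G m u S =>
      _root_.waterLevel (h G m u S) (h' G m u S) (P₀ G m u S) (P G m u S) (P' G m u S) := by
  have hN := (H.mul H).add (H'.mul H')
  exact ((K₀.sub K).sub K').ite K.sqrt (((K.mul hN).sub (K₀.mul (H.mul H))).ite
    (((K'.mul hN).sub (K₀.mul (H'.mul H'))).ite ((K₀.sqrt.mul H).div hN.sqrt) (K₀.sub K').sqrt)
    K.sqrt)

lemma antennaLevel (r : Fin 2) : LinComputable fun _ _ u S => RelayNetwork.antennaLevel u S r :=
  waterLevel (CLinComputable.g r).norm (CLinComputable.g (r + 1)).norm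
    (input fun _ _ _ => .bound none) (input fun _ _ _ => .bound (some r))
    (input fun _ _ _ => .bound (some (r + 1)))

end LinComputable

lemma CLinComputable.optVec (i : VecIdx 2) :
    CLinComputable fun _ _ u S => RelayNetwork.optVec u S i :=
  ((CLinComputable.ofReal (.antennaLevel i.2)).mul
    ((CLinComputable.g i.2).div_ofReal (CLinComputable.g i.2).norm)).mul
    ((CLinComputable.matchedDir i.1).div_ofReal LinComputable.matchedNormSq.sqrt)

lemma CLinComputable.outer_optVec (i j : VecIdx 2) :
    CLinComputable fun _ _ u S => outer (RelayNetwork.optVec u S) i j :=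
  (CLinComputable.optVec i).mul (CLinComputable.optVec j).star

/-- A rank-one optimal solution for two antennas and one user is computed by programs of size
linear in the number of transmitters. -/
theorem exists_matrixSolver : ∃ c : ℕ, ∀ (G : ℕ) (m : Fin G → ℕ), ∑ k, m k = 1 →
    ∃ alg : MatrixSolver G m 2, alg.cost ≤ c * (G + 1) ∧
      ∀ S : RelayNetwork G m 2, S.IsSDROptimal (alg.run S) ∧ (alg.run S).rank ≤ 1 := by
  -- The cost constants of the finitely many matrix entries are fixed before the dimensions, which
  -- makes the bound uniform.
  choose a ha using fun i j => (CLinComputable.outer_optVec i j).1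
  choose b hb using fun i j => (CLinComputable.outer_optVec i j).2
  refine ⟨∑ i, ∑ j, (a i j + b i j), fun G m hm => ?_⟩
  have hcard : Fintype.card (Σ k, Fin (m k)) = 1 := by simpa using hm
  obtain ⟨u, hu⟩ := Fintype.card_eq_one_iff.mp hcard
  choose p hp hpe using fun i j => ha i j G m u
  choose q hq hqe using fun i j => hb i j G m u
  have hrun : ∀ S, MatrixSolver.run ⟨p, q⟩ S = outer (RelayNetwork.optVec u S) := by
    intro S
    ext i j
    exact Complex.ext (hpe i j S) (hqe i j S)
  refine ⟨⟨p, q⟩, ?_, fun S => ?_⟩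
  · simp only [MatrixSolver.cost, Finset.sum_mul, add_mul]
    exact Finset.sum_le_sum fun i _ => Finset.sum_le_sum fun j _ => add_le_add (hp i j) (hq i j)
  · rw [hrun]
    exact ⟨RelayNetwork.isSDROptimal_optVec u hu S, rank_outer_le_one _⟩

/-! ### The theorem. -/

theorem theorem1 :
    -- (a) a rank-one optimal solution of (SDR) is computable in polynomially many operations,
    -- and the randomization procedure run on any such solution loses nothing
    (∃ c : ℕ, ∀ (G : ℕ) (m : Fin G → ℕ) (L : ℕ), 2 ≤ L → 1 ≤ ∑ k, m k → (∑ k, m k) + L ≤ 3 →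
      ∃ alg : MatrixSolver G m L, alg.cost ≤ c * (G + (∑ k, m k) + L) ^ c ∧
        ∀ S : RelayNetwork G m L, S.IsSDROptimal (alg.run S) ∧ (alg.run S).rank ≤ 1) ∧
    (∀ (G : ℕ) (m : Fin G → ℕ) (L : ℕ), 2 ≤ L → 1 ≤ ∑ k, m k → (∑ k, m k) + L ≤ 3 →
      ∀ (S : RelayNetwork G m L) (W : Matrix (VecIdx L) (VecIdx L) ℂ),
        S.IsSDROptimal W → W.rank ≤ 1 →
        ∀ (N : ℕ), 1 ≤ N → ∀ ξ : Fin N → VecIdx L → ℂ,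
          (∃ w, S.IsOutput W ξ w) ∧
          ∀ w, S.IsOutput W ξ w → S.rate (outer w) = S.rate W) ∧
    -- (b) the gap for Gaussian randomization with `N` independent draws
    (∀ (G : ℕ) (m : Fin G → ℕ) (L : ℕ), 2 ≤ L → 1 ≤ ∑ k, m k → 3 < (∑ k, m k) + L →
      ∀ (S : RelayNetwork G m L) (W : Matrix (VecIdx L) (VecIdx L) ℂ), S.IsSDROptimal W →
      ∀ (N : ℕ), 1 ≤ N →
      ∀ (Ω : Type*) [MeasurableSpace Ω] (μ : Measure Ω) [IsProbabilityMeasure μ]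
        (ξ : Fin N → Ω → VecIdx L → ℂ),
        (∀ n, IsCircularGaussian (ξ n) W μ) → iIndepFun ξ μ →
      ∀ w : Ω → VecIdx L → ℂ, (∀ ω, S.IsOutput W (fun n => ξ n ω) (w ω)) →
        ENNReal.ofReal (1 - (5 / 6 : ℝ) ^ N) ≤
          μ {ω | S.rate W - S.rate (outer (w ω)) ≤
            Real.log ((∑ k, m k : ℕ) : ℝ) + Real.log (Real.log (3 * ((L : ℝ) + 1)) + 1 / 6)
              + Real.log 48}) := by
  refine ⟨?_, ?_, ?_⟩
  · obtain ⟨c, hc⟩ := exists_matrixSolver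
    -- One constant serves as factor and as exponent; taking c + 1 keeps the exponent nonzero, so
    -- that x ≤ x^(c+1).
    refine ⟨c + 1, fun G m L hL hM hML => ?_⟩
    obtain rfl : L = 2 := by omega
    obtain ⟨alg, hcost, halg⟩ := hc G m (by omega)
    refine ⟨alg, hcost.trans (Nat.mul_le_mul (Nat.le_succ c) ?_), halg⟩
    exact (show G + 1 ≤ G + ∑ k, m k + 2 by omega).trans (Nat.le_self_pow (Nat.succ_ne_zero c) _)
  · intro G m L _ _ _ S W hW hrank N _ ξ
    simp only [RelayNetwork.IsOutput, if_pos hrank]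
    exact ⟨hW.1.1.exists_eq_outer_of_rank_le_one hrank, fun w hw => by rw [← hw]⟩
  · intro G m L hL hM _ S W hW N _ Ω _ μ _ ξ hξ hind w hw
    exact S.randomization_gap hL hM hW.1 hξ hind hw
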